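/- Let $\lambda^*,\mu>0$ and let $Y$ be a random batch size with values in $\{1,\dots,b\}$ such that $\lambda^*<\mu\,\mathbb{E}Y$. Consider single-server queues with i.i.d. inter-arrival times of mean $1/\lambda^*$, in which service completions occur at rate $\mu$ while the system is not empty; each completion removes an independent batch distributed as $Y$, or all customers present if there are fewer than $Y$ of them, in order of arrival. In the $E_k/M^Y/1$-queue ($k\ge 1$) an inter-arrival time consists of $k$ independent exponential phases of rate $k\lambda^*$; the queue is the Markov process on the states $(m,i)$, $m\ge 0$, $0\le i<k$, where $m$ is the number of customers in the system and $i$ the number of completed arrival phases. In the $D/M^Y/1$-queue every inter-arrival time equals $1/\lambda^*$; the queue is the Markov process of the pair (number of customers, time since the last arrival). If $Y\equiv 1$ these are the $E_k/M/1$- and $D/M/1$-queues. Each of these Markov processes has a unique stationary distribution, and in each queue the embedded chain of the number of customers found by successive arriving customers has a unique stationary distribution. Let $\bar\pi^k$ and $\bar\pi^D$ be the laws of the number of customers in the system under the stationary distributions of the $E_k/M^Y/1$- and the $D/M^Y/1$-queue. Let $L_k,L_D$ and $V_k,V_D$ be the means and the variances of these laws, and let $W_k,W_D$ be the expected sojourn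 times of a customer who finds upon arrival a number of customers distributed according to the stationary distribution of the embedded chain. All these quantities are finite, and the following hold. (i) If $\mathbb{P}\{Y=1\}=1$, then $\bar\pi^D\preceq_{st}\bar\pi^{k+1}\preceq_{st}\bar\pi^k$ for all $k\ge1$, where $p\preceq_{st}q$ means that $\sum_{m\ge M}p_m\le\sum_{m\ge M}q_m$ for all $M\ge0$. (ii) For every $Y$ as above (in particular for $Y\equiv1$), $L_{k+1}\le L_k$, $W_{k+1}\le W_k$ and $V_{k+1}\le V_k$ for all $k\ge1$, and $L_k\to L_D$, $W_k\to W_D$, $V_k\to V_D$ as $k\to\infty$. -/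

import Mathlib

open MeasureTheory ProbabilityTheory Filter
open scoped ENNReal NNReal Topology

noncomputable section

namespace BatchQueue

/-- The law of `Y₁ + ⋯ + Y_j` for i.i.d. batch sizes with law `Y`. -/
def batchSum (Y : Measure ℕ) : ℕ → Measure ℕ
  | 0 => Measure.dirac 0
  | j + 1 => Measure.conv (batchSum Y j) Y

/-- The law of the total size of the batches that a server which never stops completes in a time
interval of length `t`: batches are completed at the points of a Poisson process of rate `mu`. -/
def servedLaw (mu : ℝ) (Y : Measure ℕ) (t : ℝ) : Measure ℕ :=
  (poissonMeasure (mu * t).toNNReal).bind (batchSum Y)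

/-- The law of the number of customers that are still present after a time `t` without arrivals,
when it was `n` at the start. A service completion removes a batch of size `Y`, or everybody if
fewer than `Y` customers are present, and completions in an empty system do nothing; hence this
number is `max (n - S) 0` with `S` distributed as `servedLaw mu Y t` (subtraction in `ℕ` is
truncated). -/
def afterService (mu : ℝ) (Y : Measure ℕ) (n : ℕ) (t : ℝ) : Measure ℕ :=
  (servedLaw mu Y t).map (fun s => n - s)

/-! ### The queue with Erlang inter-arrival times

A state `(m, i)` says that `m` customers are present and that the customer who will arrive next has
completed `i` of the `k` arrival phases. -/

/-- The state reached from a state by the completion of an arrival phase. -/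
def nextPhase {k : ℕ} (s : ℕ × Fin k) : ℕ × Fin k :=
  if h : (s.2 : ℕ) + 1 < k then (s.1, ⟨s.2 + 1, h⟩)
  else (s.1 + 1, ⟨0, s.2.pos⟩)

/-- The infinitesimal generator of the queue with Erlang inter-arrival times that consist of `k`
exponential phases of rate `k * lam` each (mean inter-arrival time `1 / lam`), and batch services of
rate `mu`. -/
def erlangGenerator (lam mu : ℝ) (Y : Measure ℕ) (k : ℕ) (s s' : ℕ × Fin k) : ℝ :=
  k * lam * ((if s' = nextPhase s then 1 else 0) - (if s' = s then 1 else 0))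
    + mu * ((if s'.2 = s.2 then (Y.map (fun j => s.1 - j)).real {s'.1} else 0)
        - (if s' = s then 1 else 0))

/-- `P` is a stationary distribution of the Markov process with generator `erlangGenerator`:
a probability distribution with `P Q = 0`. -/
def IsErlangStationary (lam mu : ℝ) (Y : Measure ℕ) (k : ℕ) (P : Measure (ℕ × Fin k)) : Prop :=
  IsProbabilityMeasure P ∧
    ∀ s', HasSum (fun s => P.real {s} * erlangGenerator lam mu Y k s s') 0

/-! ### The queue with deterministic inter-arrival times

A state `(n, a)` says that `n` customers are present and that the time since the last arrival
is `a`; here `0 ≤ a < T`, where `T` is the inter-arrival time. -/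

/-- The law of the number of customers just after the arrival number `i + 1`, when the process
starts in `(n, a)`. The arrivals take place at the times `T - a, 2 * T - a, …`. -/
def afterArrival (mu : ℝ) (Y : Measure ℕ) (T : ℝ) (n : ℕ) (a : ℝ) : ℕ → Measure ℕ
  | 0 => (afterService mu Y n (T - a)).map (fun m => m + 1)
  | i + 1 => (afterArrival mu Y T n a i).bind
      (fun m => (afterService mu Y m T).map (fun m' => m' + 1))

/-- The law of the number of customers at time `t` when the process starts in `(n, a)` and `i`
arrivals take place in `(0, t]`. -/
def numberAt (mu : ℝ) (Y : Measure ℕ) (T t : ℝ) (n : ℕ) (a : ℝ) : ℕ → Measure ℕ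
  | 0 => afterService mu Y n t
  | i + 1 => (afterArrival mu Y T n a i).bind
      (fun m => afterService mu Y m (a + t - (i + 1) * T))

/-- The transition function of the Markov process (number present, time since the last arrival)
over a time `t`: the number of arrivals in `(0, t]` is `⌊(a + t) / T⌋`. -/
def deterministicTransition (mu : ℝ) (Y : Measure ℕ) (T t : ℝ) (s : ℕ × ℝ) : Measure (ℕ × ℝ) :=
  (numberAt mu Y T t s.1 s.2 ⌊(s.2 + t) / T⌋₊).map
    (fun m => (m, s.2 + t - ⌊(s.2 + t) / T⌋₊ * T))

/-- `P` is a stationary distribution of the queue with inter-arrival times equal to `T`. -/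
def IsDeterministicStationary (mu : ℝ) (Y : Measure ℕ) (T : ℝ) (P : Measure (ℕ × ℝ)) : Prop :=
  IsProbabilityMeasure P ∧ (∀ᵐ s ∂P, s.2 ∈ Set.Ico 0 T) ∧
    ∀ t : ℝ, 0 ≤ t → ∀ B : Set (ℕ × ℝ), MeasurableSet B →
      ∫⁻ s, deterministicTransition mu Y T t s B ∂P = P B

/-! ### Performance measures -/

/-- The law of the number of customers in the system, from the law of the full state. -/
def numberLaw {β : Type*} [MeasurableSpace β] (P : Measure (ℕ × β)) : Measure ℕ := P.map Prod.fst

/-- The mean number of customers in the system. -/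
def meanNumber (p : Measure ℕ) : ℝ := ∫ n, (n : ℝ) ∂p

/-- The variance of the number of customers in the system. -/
def varNumber (p : Measure ℕ) : ℝ := variance (fun n : ℕ => (n : ℝ)) p

/-- The stochastic order `p ⪯_st q`. -/
def StochLE (p q : Measure ℕ) : Prop := ∀ M : ℕ, p (Set.Ici M) ≤ q (Set.Ici M)

/-- `α` is a stationary law of the number of customers found by an arriving customer, when the
inter-arrival times are i.i.d. with law `A`: it is invariant for the Markov chain that leads from
`n` to the number left over from `n + 1` customers after an inter-arrival time. -/
def IsArrivalStationary (mu : ℝ) (Y : Measure ℕ) (A : Measure ℝ) (α : Measure ℕ) : Prop :=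
  IsProbabilityMeasure α ∧
    ∀ m, α {m} = ∑' n, α {n} * ∫⁻ a, afterService mu Y (n + 1) a {m} ∂A

/-- The expected sojourn time `∫₀^∞ ℙ(sojourn time > t) dt` of a customer who finds `n` customers
and who is served in order of arrival. This customer is still present after a time `t` exactly if
the `n + 1` customers present upon arrival have not all left. -/
def meanSojournGiven (mu : ℝ) (Y : Measure ℕ) (n : ℕ) : ℝ≥0∞ :=
  ∫⁻ t in Set.Ioi (0 : ℝ), afterService mu Y (n + 1) t (Set.Ioi 0)

/-- The expected sojourn time of a customer who finds a number of customers with law `α`. -/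
def meanSojourn (mu : ℝ) (Y : Measure ℕ) (α : Measure ℕ) : ℝ≥0∞ :=
  ∫⁻ n, meanSojournGiven mu Y n ∂α

end BatchQueue

end

/-! Everything rests on one family of laws on `ℕ`, those with `p (Set.Ici (M + 1)) = q * z ^ M`.
Service over a time `t` removes an independent compound Poisson amount, and `n - S ≥ M + 1` means `n
≥ M + S + 1`. Hence service keeps the ratio `z` and multiplies `q` by `E z ^ S = exp (-γ t)`, where
`γ = mu * (1 - g)` and `g` is the generating function of `Y` at `z` (`IsGeomTail.serve`,
`IsGeomTail.afterService`). An arrival turns first term `z` into first term `1` (`IsGeomTail.succ`).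
So a stationary law of this shape exists once `z` solves `z = E exp (-γ A)` for the inter-arrival
time `A`. The number found by an arrival is then geometric, and the full state law is explicit in
the arrival phase or in the age. In both models the number of customers has first tail term `λ (1 -
z) / γ` and mean `λ / γ`, and the sojourn time is exponential with rate `γ`.

Uniqueness is a separate coupling-free argument, `invariant_unique`: the minimum of two invariant
probability vectors is again invariant, and the two remainders would have disjoint supports closed
under possible transitions. It applies because arrivals without any service are always possible. The
Erlang process is reduced to a discrete chain by uniformization. The deterministic one is reduced to
its age, which must be uniform, together with a kernel that is invariant over one period.

Comparison thus becomes comparison of the roots `z`. For `k` phases the equation is `z * (1 + γ / (λ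
k)) ^ k = 1`. Since `(1 + x / k) ^ k` increases with `k`, a root for `k + 1` can be chosen below a
given root for `k`, and the decreasing roots converge to a solution of the exponential equation of
deterministic arrivals. Means and sojourn times increase with `z` because `g` does. The variance
needs in addition that `(1 - g) / (1 - z)` increases with `z` (`varOf_mono`). For unit batches `g =
z`, so the first tail term is always `λ / μ` and only the ratio changes, which gives the stochastic
order. -/

namespace BatchQueue

/-! ### Uniqueness of invariant vectors of a stochastic matrix -/

/-- A stochastic matrix on a countable set has at most one invariant probability vector if the
orbits of any two states under some map that follows possible transitions meet. -/
theorem invariant_unique {S : Type*} (K : S → S → ℝ≥0∞) (hK : ∀ s, ∑' t, K s t = 1)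
    (f : S → S) (hf : ∀ s, K s (f s) ≠ 0) (hmeet : ∀ s t, ∃ i j, f^[i] s = f^[j] t)
    (p q : S → ℝ≥0∞) (hp1 : ∑' s, p s = 1) (hq1 : ∑' s, q s = 1)
    (hp : ∀ t, p t = ∑' s, p s * K s t) (hq : ∀ t, q t = ∑' s, q s * K s t) : p = q := by
  have total : ∀ u : S → ℝ≥0∞, ∑' t, ∑' s, u s * K s t = ∑' s, u s := by
    intro u
    rw [ENNReal.tsum_comm]
    simp [ENNReal.tsum_mul_left, hK]
  -- The common part of both vectors is subinvariant. As `K` preserves total mass, it cannot be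
  -- strictly subinvariant anywhere.
  set m : S → ℝ≥0∞ := fun s => min (p s) (q s) with hm
  have hmle : ∀ t, ∑' s, m s * K s t ≤ m t := by
    intro t
    refine le_min ?_ ?_
    · rw [hp t]; exact ENNReal.tsum_le_tsum fun s => mul_le_mul_left (min_le_left _ _) _
    · rw [hq t]; exact ENNReal.tsum_le_tsum fun s => mul_le_mul_left (min_le_right _ _) _
  have hmfin : ∑' s, m s ≠ ∞ :=
    ne_top_of_le_ne_top (by simp [hp1]) (ENNReal.tsum_le_tsum (fun s => min_le_left (p s) (q s)))
  have hmt : ∀ t, m t ≠ ∞ := fun t => ENNReal.ne_top_of_tsum_ne_top hmfin t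
  have hminv : ∀ t, ∑' s, m s * K s t = m t := by
    intro t
    by_contra hne
    have hlt := lt_of_le_of_ne (hmle t) hne
    have := ENNReal.tsum_lt_tsum (by rw [total]; exact hmfin) hmle hlt
    rw [total] at this
    exact lt_irrefl _ this
  have hres : ∀ r : S → ℝ≥0∞, (∀ s, m s ≤ r s) → (∀ t, r t = ∑' s, r s * K s t) →
      ∀ t, r t - m t = ∑' s, (r s - m s) * K s t := by
    intro r hmr hr t
    have h1 : r t = m t + ∑' s, (r s - m s) * K s t := by
      conv_lhs => rw [hr t]
      rw [← hminv t, ← ENNReal.tsum_add]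
      refine tsum_congr fun s => ?_
      rw [← add_mul, add_tsub_cancel_of_le (hmr s)]
    conv_lhs => rw [h1]
    exact ENNReal.add_sub_cancel_left (hmt t)
  have hprop : ∀ u : S → ℝ≥0∞, (∀ t, u t = ∑' s, u s * K s t) → ∀ s, u s ≠ 0 →
      ∀ i, u (f^[i] s) ≠ 0 := by
    intro u hu s hs i
    induction i with
    | zero => simpa
    | succ i ih =>
      rw [Function.iterate_succ_apply', hu]
      intro h0
      have := ENNReal.tsum_eq_zero.1 h0 (f^[i] s)
      rcases mul_eq_zero.1 this with h | h
      · exact ih h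
      · exact hf _ h
  -- The remainders `p - m` and `q - m` are invariant, so positivity propagates along `f`. At a
  -- point where the orbits meet both would be positive, but one of them vanishes at every point.
  have key : ∀ s t, p s - m s ≠ 0 → q t - m t ≠ 0 → False := by
    intro s t hs ht
    obtain ⟨i, j, hij⟩ := hmeet s t
    have h1 := hprop (fun s => p s - m s) (hres p (fun s => min_le_left _ _) hp) s hs i
    have h2 := hprop (fun s => q s - m s) (hres q (fun s => min_le_right _ _) hq) t ht j
    rw [hij] at h1
    rcases le_total (p (f^[j] t)) (q (f^[j] t)) with h | h
    · exact h1 (by simp [hm, h])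
    · exact h2 (by simp [hm, h])
  have fin : ∀ p q : S → ℝ≥0∞, ∑' s, p s = 1 → ∑' s, q s = 1 → (∀ s, p s ≤ q s) → p = q := by
    intro p q hp1 hq1 hle
    funext s
    by_contra hne
    have := ENNReal.tsum_lt_tsum (by simp [hp1]) hle (lt_of_le_of_ne (hle s) hne)
    simp [hp1, hq1] at this
  by_cases h : ∃ s, p s - m s ≠ 0
  · obtain ⟨s, hs⟩ := h
    refine (fin q p hq1 hp1 fun t => ?_).symm
    by_contra hlt
    exact key s t hs (by simp only [ne_eq, tsub_eq_zero_iff_le, hm]; simpa using hlt)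
  · push Not at h
    refine fin p q hp1 hq1 fun t => ?_
    have := h t
    rw [tsub_eq_zero_iff_le] at this
    exact this.trans (min_le_right _ _)

theorem measure_eq_tsum_singleton {S : Type*} [MeasurableSpace S] [Countable S]
    [MeasurableSingletonClass S] (p : Measure S) : ∑' s, p {s} = p Set.univ := by
  have := Measure.tsum_indicator_apply_singleton p Set.univ MeasurableSet.univ
  simpa using this

/-- Kernel form of `invariant_unique`. -/
theorem invariant_measure_unique {S : Type*} [MeasurableSpace S] [Countable S]
    [MeasurableSingletonClass S] (K : S → Measure S) (hK : ∀ s, IsProbabilityMeasure (K s))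
    (f : S → S) (hf : ∀ s, K s {f s} ≠ 0) (hmeet : ∀ s t, ∃ i j, f^[i] s = f^[j] t)
    (p q : Measure S) [IsProbabilityMeasure p] [IsProbabilityMeasure q]
    (hp : ∀ t, p {t} = ∑' s, p {s} * K s {t}) (hq : ∀ t, q {t} = ∑' s, q {s} * K s {t}) :
    p = q := by
  have := invariant_unique (fun s t => K s {t}) (fun s => by simp [measure_eq_tsum_singleton]) f hf
    hmeet (fun s => p {s}) (fun s => q {s}) (by simp [measure_eq_tsum_singleton])
    (by simp [measure_eq_tsum_singleton]) hp hq
  exact Measure.ext_of_singleton fun s => congrFun this s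

theorem bind_apply_singleton {S R : Type*} [MeasurableSpace S] [DiscreteMeasurableSpace S]
    [Countable S] [MeasurableSpace R]
    (p : Measure S) (K : S → Measure R) {B : Set R} (hB : MeasurableSet B) :
    p.bind K B = ∑' s, p {s} * K s B := by
  rw [Measure.bind_apply hB Measurable.of_discrete.aemeasurable, lintegral_countable']
  simp_rw [mul_comm]

/-! ### Laws on `ℕ` with geometric tails -/

/-- The tail of `p` is `q, q * z, q * z ^ 2, …` from `1` on. -/
def IsGeomTail (z q : ℝ≥0∞) (p : Measure ℕ) : Prop :=
  IsProbabilityMeasure p ∧ ∀ M : ℕ, p (Set.Ici (M + 1)) = q * z ^ M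

theorem ext_of_tail {p q : Measure ℕ} [IsFiniteMeasure p]
    (h : ∀ M, p (Set.Ici M) = q (Set.Ici M)) : p = q := by
  refine Measure.ext_of_singleton fun m => ?_
  have hs : ({m} : Set ℕ) = Set.Ici m \ Set.Ici (m + 1) := by
    ext n; simp; omega
  have hsub : Set.Ici (m + 1) ⊆ Set.Ici m := Set.Ici_subset_Ici.2 (Nat.le_succ m)
  rw [hs, measure_sdiff hsub (by measurability) (measure_ne_top _ _),
    measure_sdiff hsub (by measurability) (by rw [← h]; exact measure_ne_top _ _), h, h]

theorem IsGeomTail.unique {z q : ℝ≥0∞} {p p' : Measure ℕ} (h : IsGeomTail z q p)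
    (h' : IsGeomTail z q p') : p = p' := by
  have := h.1
  have := h'.1
  refine ext_of_tail fun M => ?_
  cases M with
  | zero => simp
  | succ M => rw [h.2, h'.2]

/-- This is the effect of an arrival: the customer joins a geometric number of others, and the first
tail term is reset to `1`. -/
theorem IsGeomTail.succ {z : ℝ≥0∞} {p : Measure ℕ} (h : IsGeomTail z z p) :
    IsGeomTail z 1 (p.map (fun m => m + 1)) := by
  have := h.1
  refine ⟨Measure.isProbabilityMeasure_map (by fun_prop), fun M => ?_⟩
  rw [Measure.map_apply (by fun_prop) (by measurability)]
  have : (fun m : ℕ => m + 1) ⁻¹' Set.Ici (M + 1) = Set.Ici M := by ext; simp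
  rw [this]
  cases M with
  | zero => simp
  | succ M => rw [h.2]; ring

theorem exists_isGeomTail_self {s : ℝ} (hs0 : 0 < s) (hs1 : s < 1) :
    ∃ p, IsGeomTail (ENNReal.ofReal s) (ENNReal.ofReal s) p := by
  -- The success probability is `1 - s`, so that `s` is the ratio of the tail.
  set u : unitInterval := ⟨1 - s, by constructor <;> linarith⟩ with hu
  have hu0 : u ≠ 0 := by
    intro h
    have := congrArg Subtype.val h
    simp [hu] at this
    linarith
  refine ⟨geometricMeasure u, inferInstance, fun M => ?_⟩
  have hcompl : (Set.Ici (M + 1))ᶜ = ((Finset.range (M + 1) : Finset ℕ) : Set ℕ) := by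
    ext; simp
  have hfin : geometricMeasure u (Set.Ici (M + 1))ᶜ = ENNReal.ofReal (1 - s ^ (M + 1)) := by
    rw [hcompl, ← sum_measure_singleton]
    simp_rw [geometricMeasure_singleton hu0]
    rw [← ENNReal.ofReal_sum_of_nonneg fun n _ => geometricMeasure_nonneg u n]
    congr 1
    rw [← Finset.sum_mul]
    simp only [hu, sub_sub_cancel]
    rw [mul_comm, mul_neg_geom_sum]
  have h2 := prob_compl_eq_one_sub (μ := geometricMeasure u) (s := (Set.Ici (M + 1))ᶜ)
    (by measurability)
  rw [compl_compl, hfin] at h2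
  rw [h2, ← ENNReal.ofReal_one, ← ENNReal.ofReal_sub _ (by
    have := pow_le_one₀ hs0.le hs1.le (n := M + 1); linarith), ← ENNReal.ofReal_pow hs0.le,
    ← ENNReal.ofReal_mul hs0.le]
  congr 1; ring

/-- Serving an independent amount keeps the tail geometric with the same ratio. -/
theorem IsGeomTail.serve {z q : ℝ≥0∞} {p : Measure ℕ} (h : IsGeomTail z q p) (ν : Measure ℕ)
    [IsProbabilityMeasure ν] :
    IsGeomTail z (q * ∫⁻ s, z ^ s ∂ν) (p.bind fun n => ν.map fun s => n - s) := by
  have := h.1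
  have hpr : ∀ n : ℕ, IsProbabilityMeasure (ν.map fun s => n - s) := fun n =>
    Measure.isProbabilityMeasure_map Measurable.of_discrete.aemeasurable
  refine ⟨⟨?_⟩, fun M => ?_⟩
  · rw [Measure.bind_apply MeasurableSet.univ Measurable.of_discrete.aemeasurable]
    simp
  · rw [Measure.bind_apply (by measurability) Measurable.of_discrete.aemeasurable]
    have h1 : ∀ n : ℕ, (ν.map fun s => n - s) (Set.Ici (M + 1))
        = ∫⁻ s, (Set.Ici (M + s + 1)).indicator 1 n ∂ν := by
      intro n
      rw [Measure.map_apply Measurable.of_discrete (by measurability),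
        ← lintegral_indicator_one (by measurability)]
      refine lintegral_congr fun s => ?_
      simp only [Set.indicator, Set.mem_preimage, Set.mem_Ici]
      congr 1
      apply propext
      omega
    simp_rw [h1]
    rw [lintegral_lintegral_swap Measurable.of_discrete.aemeasurable]
    simp_rw [lintegral_indicator_one (measurableSet_Ici), h.2, pow_add]
    rw [lintegral_const_mul _ Measurable.of_discrete, lintegral_const_mul _ Measurable.of_discrete]
    ring

/-- Mixtures of laws with geometric tails. -/
theorem IsGeomTail.mix {β : Type*} [MeasurableSpace β] {z : ℝ≥0∞} {q : β → ℝ≥0∞} (A : Measure β)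
    [IsProbabilityMeasure A] {f : β → Measure ℕ} (hf : Measurable f)
    (hq : Measurable q) (h : ∀ᵐ a ∂A, IsGeomTail z (q a) (f a)) :
    IsGeomTail z (∫⁻ a, q a ∂A) (A.bind f) := by
  refine ⟨⟨?_⟩, fun M => ?_⟩
  · rw [Measure.bind_apply MeasurableSet.univ hf.aemeasurable]
    have : ∀ᵐ a ∂A, f a Set.univ = 1 := h.mono fun a ha => ha.1.measure_univ
    rw [lintegral_congr_ae this]
    simp
  · rw [Measure.bind_apply (by measurability) hf.aemeasurable,
      lintegral_congr_ae (h.mono fun a ha => ha.2 M), lintegral_mul_const _ hq]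

/-- Summation by parts: `c M` is counted exactly when `n ≥ M + 1`. Increments `1` and `2 * M + 1`
give the first two moments. -/
theorem lintegral_eq_tsum_tail (p : Measure ℕ) (c : ℕ → ℝ≥0∞) :
    ∫⁻ n, ∑ M ∈ Finset.range n, c M ∂p = ∑' M, c M * p (Set.Ici (M + 1)) := by
  have h1 : ∀ n : ℕ, ∑ M ∈ Finset.range n, c M
      = ∑' M, c M * (Set.Ici (M + 1)).indicator 1 n := by
    intro n
    rw [tsum_eq_sum (s := Finset.range n)]
    · refine Finset.sum_congr rfl fun M hM => ?_
      have : M + 1 ≤ n := Finset.mem_range.1 hM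
      simp [Set.indicator, this]
    · intro M hM
      have : ¬ M + 1 ≤ n := fun h => hM (Finset.mem_range.2 h)
      simp [Set.indicator, this]
  simp_rw [h1]
  rw [lintegral_tsum fun M => Measurable.of_discrete.aemeasurable]
  refine tsum_congr fun M => ?_
  rw [lintegral_const_mul _ Measurable.of_discrete, lintegral_indicator_one measurableSet_Ici]

theorem IsGeomTail.lintegral_id {s q : ℝ} (hs0 : 0 < s) (hs1 : s < 1) (hq : 0 ≤ q) {p : Measure ℕ}
    (h : IsGeomTail (ENNReal.ofReal s) (ENNReal.ofReal q) p) :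
    ∫⁻ n, ENNReal.ofReal (n : ℝ) ∂p = ENNReal.ofReal (q / (1 - s)) := by
  have h1 := lintegral_eq_tsum_tail p (fun _ => 1)
  simp only [Finset.sum_const, Finset.card_range, nsmul_eq_mul, mul_one, one_mul] at h1
  simp_rw [ENNReal.ofReal_natCast, h1, h.2]
  have hsum := (hasSum_geometric_of_lt_one hs0.le hs1).mul_left q
  rw [div_eq_mul_inv, ← hsum.tsum_eq, ENNReal.ofReal_tsum_of_nonneg (fun n => by positivity)
    hsum.summable]
  refine tsum_congr fun n => ?_
  rw [ENNReal.ofReal_mul hq, ENNReal.ofReal_pow hs0.le]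

theorem IsGeomTail.lintegral_sq {s q : ℝ} (hs0 : 0 < s) (hs1 : s < 1) (hq : 0 ≤ q) {p : Measure ℕ}
    (h : IsGeomTail (ENNReal.ofReal s) (ENNReal.ofReal q) p) :
    ∫⁻ n, ENNReal.ofReal ((n : ℝ) ^ 2) ∂p = ENNReal.ofReal (q * (1 + s) / (1 - s) ^ 2) := by
  have h1 := lintegral_eq_tsum_tail p (fun M => ENNReal.ofReal (2 * M + 1))
  have h2 : ∀ n : ℕ, ∑ M ∈ Finset.range n, ENNReal.ofReal (2 * (M : ℝ) + 1)
      = ENNReal.ofReal ((n : ℝ) ^ 2) := by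
    intro n
    rw [← ENNReal.ofReal_sum_of_nonneg fun n _ => by positivity]
    congr 1
    induction n with
    | zero => simp
    | succ n ih => rw [Finset.sum_range_succ, ih]; push_cast; ring
  simp_rw [h2] at h1
  simp_rw [h1, h.2]
  have ha : HasSum (fun n : ℕ => (n : ℝ) * s ^ n) (s / (1 - s) ^ 2) :=
    hasSum_coe_mul_geometric_of_norm_lt_one (by rwa [Real.norm_of_nonneg hs0.le])
  have hsum := ((ha.mul_left 2).add (hasSum_geometric_of_lt_one hs0.le hs1)).mul_left q
  have hne : 1 - s ≠ 0 := by linarith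
  have : q * (1 + s) / (1 - s) ^ 2 = q * (2 * (s / (1 - s) ^ 2) + (1 - s)⁻¹) := by
    field_simp; ring
  rw [this, ← hsum.tsum_eq, ENNReal.ofReal_tsum_of_nonneg (fun n => by positivity) hsum.summable]
  refine tsum_congr fun n => ?_
  rw [← ENNReal.ofReal_pow hs0.le, ← ENNReal.ofReal_mul hq, ← ENNReal.ofReal_mul (by positivity)]
  congr 1; ring

theorem IsGeomTail.memLp {s q : ℝ} (hs0 : 0 < s) (hs1 : s < 1) (hq : 0 ≤ q) {p : Measure ℕ}
    (h : IsGeomTail (ENNReal.ofReal s) (ENNReal.ofReal q) p) :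
    MemLp (fun n : ℕ => (n : ℝ)) 2 p := by
  rw [memLp_two_iff_integrable_sq Measurable.of_discrete.aestronglyMeasurable]
  refine ⟨Measurable.of_discrete.aestronglyMeasurable, ?_⟩
  rw [hasFiniteIntegral_iff_ofReal (ae_of_all _ fun n => by positivity), h.lintegral_sq hs0 hs1 hq]
  exact ENNReal.ofReal_lt_top

theorem IsGeomTail.meanNumber_eq {s q : ℝ} (hs0 : 0 < s) (hs1 : s < 1) (hq : 0 ≤ q)
    {p : Measure ℕ} (h : IsGeomTail (ENNReal.ofReal s) (ENNReal.ofReal q) p) :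
    meanNumber p = q / (1 - s) := by
  rw [meanNumber, integral_eq_lintegral_of_nonneg_ae (ae_of_all _ fun n => by positivity)
    Measurable.of_discrete.aestronglyMeasurable, h.lintegral_id hs0 hs1 hq, ENNReal.toReal_ofReal]
  exact div_nonneg hq (by linarith)

theorem IsGeomTail.varNumber_eq {s q : ℝ} (hs0 : 0 < s) (hs1 : s < 1) (hq : 0 ≤ q)
    {p : Measure ℕ} (h : IsGeomTail (ENNReal.ofReal s) (ENNReal.ofReal q) p) :
    varNumber p = q * (1 + s) / (1 - s) ^ 2 - (q / (1 - s)) ^ 2 := by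
  have := h.1
  rw [varNumber, variance_eq_sub (h.memLp hs0 hs1 hq)]
  congr 1
  · have : ∀ n : ℕ, ((fun n : ℕ => (n : ℝ)) ^ 2) n = (n : ℝ) ^ 2 := fun n => rfl
    simp_rw [this]
    rw [integral_eq_lintegral_of_nonneg_ae (ae_of_all _ fun n => by positivity)
      Measurable.of_discrete.aestronglyMeasurable, h.lintegral_sq hs0 hs1 hq, ENNReal.toReal_ofReal]
    positivity
  · rw [← h.meanNumber_eq hs0 hs1 hq, meanNumber]

/-! ### The service process -/

section Service

variable {mu : ℝ} {Y : Measure ℕ}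

instance isProbabilityMeasure_batchSum [IsProbabilityMeasure Y] (j : ℕ) : IsProbabilityMeasure (batchSum Y j) := by
  induction j with
  | zero => rw [batchSum]; infer_instance
  | succ j ih => rw [batchSum]; infer_instance

theorem isProbabilityMeasure_bind {β γ : Type*} [MeasurableSpace β] [MeasurableSpace γ]
    (p : Measure β) [IsProbabilityMeasure p] {f : β → Measure γ} (hf : Measurable f)
    (h : ∀ᵐ a ∂p, IsProbabilityMeasure (f a)) : IsProbabilityMeasure (p.bind f) := by
  refine ⟨?_⟩
  rw [Measure.bind_apply MeasurableSet.univ hf.aemeasurable,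
    lintegral_congr_ae (h.mono fun a ha => ha.measure_univ)]
  simp

instance isProbabilityMeasure_servedLaw [IsProbabilityMeasure Y] (t : ℝ) : IsProbabilityMeasure (servedLaw mu Y t) :=
  isProbabilityMeasure_bind _ Measurable.of_discrete (ae_of_all _ fun _ => inferInstance)

instance isProbabilityMeasure_afterService [IsProbabilityMeasure Y] (n : ℕ) (t : ℝ) :
    IsProbabilityMeasure (afterService mu Y n t) :=
  Measure.isProbabilityMeasure_map Measurable.of_discrete.aemeasurable

theorem measurable_servedLaw : Measurable (servedLaw mu Y) := by
  have h1 : Measurable fun r : ℝ≥0 => poissonMeasure r := by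
    refine Measure.measurable_of_measurable_coe _ fun B hB => ?_
    simp_rw [poissonMeasure, Measure.sum_apply _ hB, Measure.smul_apply]
    refine Measurable.tsum fun n => ?_
    simp only [smul_eq_mul]
    fun_prop
  exact (Measure.measurable_bind' (Measurable.of_discrete)).comp (h1.comp (by fun_prop))

theorem measurable_afterService (n : ℕ) : Measurable (afterService mu Y n) :=
  (Measure.measurable_map _ Measurable.of_discrete).comp measurable_servedLaw

theorem lintegral_batchSum [IsProbabilityMeasure Y] (z : ℝ≥0∞) (j : ℕ) :
    ∫⁻ s, z ^ s ∂(batchSum Y j) = (∫⁻ s, z ^ s ∂Y) ^ j := by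
  induction j with
  | zero => simp [batchSum]
  | succ j ih =>
    rw [batchSum, Measure.lintegral_conv Measurable.of_discrete]
    simp_rw [pow_add]
    simp_rw [lintegral_const_mul _ (Measurable.of_discrete (f := fun s : ℕ => z ^ s))]
    rw [lintegral_mul_const _ Measurable.of_discrete, ih, pow_one]

theorem lintegral_poissonMeasure_pow (r : ℝ≥0) {g : ℝ} (hg : 0 ≤ g) :
    ∫⁻ j, ENNReal.ofReal g ^ j ∂(poissonMeasure r) = ENNReal.ofReal (Real.exp (-(r * (1 - g)))) := by
  rw [lintegral_countable']
  simp_rw [poissonMeasure_singleton]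
  have hs : HasSum (fun n : ℕ => Real.exp (-r) * ((r * g) ^ n / n.factorial))
      (Real.exp (-(r * (1 - g)))) := by
    have := (NormedSpace.expSeries_div_hasSum_exp ((r : ℝ) * g)).mul_left (Real.exp (-r))
    rw [← Real.exp_eq_exp_ℝ, ← Real.exp_add] at this
    rwa [show -(r * (1 - g)) = -(r : ℝ) + r * g by ring]
  rw [← hs.tsum_eq, ENNReal.ofReal_tsum_of_nonneg (fun n => by positivity) hs.summable]
  refine tsum_congr fun n => ?_
  rw [← ENNReal.ofReal_pow hg, ← ENNReal.ofReal_mul (by positivity)]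
  congr 1
  rw [mul_pow]; ring

/-- The generating function of a compound Poisson law is that of the Poisson count evaluated at the
generating function of one batch. -/
theorem lintegral_servedLaw [IsProbabilityMeasure Y] {z : ℝ≥0∞} {g : ℝ} (hg0 : 0 ≤ g)
    (hg : ∫⁻ s, z ^ s ∂Y = ENNReal.ofReal g) (hmu : 0 < mu) {t : ℝ} (ht : 0 ≤ t) :
    ∫⁻ s, z ^ s ∂(servedLaw mu Y t) = ENNReal.ofReal (Real.exp (-(mu * (1 - g) * t))) := by
  rw [servedLaw, Measure.lintegral_bind Measurable.of_discrete.aemeasurable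
    Measurable.of_discrete.aemeasurable]
  simp_rw [lintegral_batchSum, hg]
  rw [lintegral_poissonMeasure_pow _ hg0, Real.coe_toNNReal _ (by positivity)]
  congr 2; ring

/-- With positive probability there is no service completion. -/
theorem afterService_self_ne_zero (n : ℕ) (t : ℝ) : afterService mu Y n t {n} ≠ 0 := by
  have h0 : servedLaw mu Y t {0} ≠ 0 := by
    rw [servedLaw, bind_apply_singleton _ _ (measurableSet_singleton 0)]
    intro h
    have := ENNReal.tsum_eq_zero.1 h 0
    rw [poissonMeasure_singleton] at this
    simp [batchSum] at this
    exact absurd this (not_le.2 (Real.exp_pos _))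
  rw [afterService, Measure.map_apply Measurable.of_discrete (measurableSet_singleton n)]
  refine fun h => h0 (measure_mono_null ?_ h)
  simp

theorem IsGeomTail.afterService [IsProbabilityMeasure Y] {z q : ℝ≥0∞} {p : Measure ℕ} (h : IsGeomTail z q p)
    {g : ℝ} (hg0 : 0 ≤ g) (hg : ∫⁻ s, z ^ s ∂Y = ENNReal.ofReal g) (hmu : 0 < mu) {t : ℝ}
    (ht : 0 ≤ t) :
    IsGeomTail z (q * ENNReal.ofReal (Real.exp (-(mu * (1 - g) * t))))
      (p.bind fun n => afterService mu Y n t) := by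
  rw [← lintegral_servedLaw hg0 hg hmu ht]
  exact h.serve _

/-! ### The embedded chain at arrivals -/

/-- The transition law of the chain embedded at arrivals. -/
noncomputable def arrivalStep (mu : ℝ) (Y : Measure ℕ) (A : Measure ℝ) (n : ℕ) : Measure ℕ :=
  A.bind (BatchQueue.afterService mu Y (n + 1))

theorem arrivalStep_singleton (A : Measure ℝ) (n m : ℕ) :
    arrivalStep mu Y A n {m} = ∫⁻ a, BatchQueue.afterService mu Y (n + 1) a {m} ∂A :=
  Measure.bind_apply (measurableSet_singleton m) (measurable_afterService _).aemeasurable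

/-- With positive probability nobody is served between two arrivals, so `n ↦ n + 1` is a possible
transition, and any two orbits of the successor map meet. -/
theorem isArrivalStationary_unique [IsProbabilityMeasure Y] {A : Measure ℝ} [IsProbabilityMeasure A] {α β : Measure ℕ}
    (hα : IsArrivalStationary mu Y A α) (hβ : IsArrivalStationary mu Y A β) : α = β := by
  have := hα.1
  have := hβ.1
  refine invariant_measure_unique (arrivalStep mu Y A)
    (fun n => isProbabilityMeasure_bind _ (measurable_afterService _)
      (ae_of_all _ fun _ => inferInstance)) (fun n => n + 1) (fun n => ?_) (fun s t => ?_) α β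
    (fun t => ?_) (fun t => ?_)
  · rw [arrivalStep_singleton]
    intro h
    have h := (lintegral_eq_zero_iff
      ((Measure.measurable_coe (measurableSet_singleton _)).comp (measurable_afterService _))).1 h
    obtain ⟨a, ha⟩ := h.exists
    exact afterService_self_ne_zero _ _ ha
  · exact ⟨t, s, by simp [add_comm]⟩
  · simp_rw [arrivalStep_singleton]; exact hα.2 t
  · simp_rw [arrivalStep_singleton]; exact hβ.2 t

/-- The arrival resets the first tail term to `1`, and service during the inter-arrival time
multiplies it by the Laplace transform of `A` at `mu * (1 - g)`. The root equation `hz` brings it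
back to `z`. -/
theorem isArrivalStationary_of_isGeomTail [IsProbabilityMeasure Y] {z : ℝ≥0∞} {α : Measure ℕ} (h : IsGeomTail z z α)
    {g : ℝ} (hg0 : 0 ≤ g) (hg : ∫⁻ s, z ^ s ∂Y = ENNReal.ofReal g) (hmu : 0 < mu)
    {A : Measure ℝ} [IsProbabilityMeasure A] (hA : ∀ᵐ a ∂A, 0 ≤ a)
    (hz : ∫⁻ a, ENNReal.ofReal (Real.exp (-(mu * (1 - g) * a))) ∂A = z) :
    IsArrivalStationary mu Y A α := by
  refine ⟨h.1, fun m => ?_⟩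
  have hm : ∀ a, ((α.map (fun m => m + 1)).bind fun n => BatchQueue.afterService mu Y n a) {m}
      = ∑' n, α {n} * BatchQueue.afterService mu Y (n + 1) a {m} := by
    intro a
    rw [← Measure.bind_dirac_eq_map _ Measurable.of_discrete, Measure.bind_bind
      Measurable.of_discrete.aemeasurable Measurable.of_discrete.aemeasurable,
      bind_apply_singleton _ _ (measurableSet_singleton m)]
    refine tsum_congr fun n => ?_
    rw [Measure.dirac_bind Measurable.of_discrete]
  have hmeas : ∀ n, Measurable fun a => BatchQueue.afterService mu Y (n + 1) a {m} := fun n =>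
    (Measure.measurable_coe (measurableSet_singleton _)).comp (measurable_afterService _)
  have hmeas2 : Measurable fun a =>
      (α.map (fun m => m + 1)).bind fun n => BatchQueue.afterService mu Y n a := by
    refine Measure.measurable_of_measurable_coe _ fun B hB => ?_
    simp_rw [bind_apply_singleton _ _ hB]
    exact Measurable.tsum fun n => ((Measure.measurable_coe hB).comp
      (measurable_afterService _)).const_mul _
  have hmix := IsGeomTail.mix (z := z) (q := fun a =>
    ENNReal.ofReal (Real.exp (-(mu * (1 - g) * a)))) A hmeas2 (by fun_prop) (hA.mono fun a ha => by
      have := h.succ.afterService (mu := mu) hg0 hg hmu ha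
      rwa [one_mul] at this)
  rw [hz] at hmix
  conv_lhs => rw [h.unique hmix, Measure.bind_apply (measurableSet_singleton m)
    hmeas2.aemeasurable]
  simp_rw [hm]
  rw [lintegral_tsum fun n => ((hmeas n).const_mul _).aemeasurable]
  exact tsum_congr fun n => lintegral_const_mul _ (hmeas n)

/-- The sojourn time exceeds `t` with probability equal to the first tail term after service for a
time `t`, namely `exp (-γ t)`. It is therefore exponential with rate `γ = mu * (1 - g)`. -/
theorem meanSojourn_of_isGeomTail [IsProbabilityMeasure Y] {z : ℝ≥0∞} {α : Measure ℕ} (h : IsGeomTail z z α)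
    {g : ℝ} (hg0 : 0 ≤ g) (hg1 : g < 1) (hg : ∫⁻ s, z ^ s ∂Y = ENNReal.ofReal g) (hmu : 0 < mu) :
    meanSojourn mu Y α = ENNReal.ofReal (1 / (mu * (1 - g))) := by
  have hγ : 0 < mu * (1 - g) := mul_pos hmu (by linarith)
  have hmeas : ∀ n, Measurable fun a => BatchQueue.afterService mu Y n a (Set.Ioi 0) := fun n =>
    (Measure.measurable_coe measurableSet_Ioi).comp (measurable_afterService _)
  have hin : ∀ t ∈ Set.Ioi (0 : ℝ), ∫⁻ n, BatchQueue.afterService mu Y (n + 1) t (Set.Ioi 0) ∂α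
      = ENNReal.ofReal (Real.exp (-(mu * (1 - g)) * t)) := by
    intro t ht
    have h1 := (h.succ.afterService (mu := mu) hg0 hg hmu (le_of_lt ht)).2 0
    rw [Measure.bind_apply (by measurability) Measurable.of_discrete.aemeasurable,
      lintegral_map Measurable.of_discrete Measurable.of_discrete] at h1
    simp only [one_mul, pow_zero, mul_one, zero_add] at h1
    rw [neg_mul, ← h1]
    rfl
  simp_rw [meanSojourn, meanSojournGiven]
  rw [lintegral_lintegral_swap]
  · rw [setLIntegral_congr_fun measurableSet_Ioi hin,
      ← ofReal_integral_eq_lintegral_ofReal (integrableOn_exp_mul_Ioi (by linarith) 0)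
        (ae_of_all _ fun t => (Real.exp_pos _).le),
      integral_exp_mul_Ioi (by linarith)]
    simp [neg_div_neg_eq]
  · exact (measurable_from_prod_countable_right fun n => hmeas (n + 1)).aemeasurable

end Service

/-! ### The queue with Erlang arrivals -/

section Erlang

variable {lam mu : ℝ} {Y : Measure ℕ} {k : ℕ}

/-- The jump chain of the uniformized process. -/
noncomputable def erlangStep (lam mu : ℝ) (Y : Measure ℕ) (k : ℕ) (s : ℕ × Fin k) :
    Measure (ℕ × Fin k) :=
  ENNReal.ofReal (k * lam / (k * lam + mu)) • Measure.dirac (nextPhase s) +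
    ENNReal.ofReal (mu / (k * lam + mu)) • (Y.map fun j => s.1 - j).map fun m => (m, s.2)

theorem isProbabilityMeasure_erlangStep [IsProbabilityMeasure Y] (hlam : 0 < lam) (hmu : 0 < mu)
    (s : ℕ × Fin k) : IsProbabilityMeasure (erlangStep lam mu Y k s) := by
  have h1 : IsProbabilityMeasure (Y.map fun j => s.1 - j) :=
    Measure.isProbabilityMeasure_map Measurable.of_discrete.aemeasurable
  have h2 : IsProbabilityMeasure ((Y.map fun j => s.1 - j).map fun m => (m, s.2)) :=
    Measure.isProbabilityMeasure_map Measurable.of_discrete.aemeasurable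
  refine ⟨?_⟩
  simp only [erlangStep, Measure.add_apply, Measure.smul_apply, measure_univ, smul_eq_mul, mul_one]
  rw [← ENNReal.ofReal_add (by positivity) (by positivity), ← ENNReal.ofReal_one]
  congr 1
  field_simp

/-- Uniformization: the total event rate `k * lam + mu` is the same in every state, so the generator
is this rate times (step kernel minus identity). -/
theorem erlangGenerator_eq [IsProbabilityMeasure Y] (hlam : 0 < lam) (hmu : 0 < mu)
    (s s' : ℕ × Fin k) :
    erlangGenerator lam mu Y k s s' =
      (k * lam + mu) * ((erlangStep lam mu Y k s).real {s'} - if s' = s then 1 else 0) := by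
  have h1 : IsProbabilityMeasure (Y.map fun j => s.1 - j) :=
    Measure.isProbabilityMeasure_map Measurable.of_discrete.aemeasurable
  have hs : ((Y.map fun j => s.1 - j).map fun m => (m, s.2)).real {s'}
      = if s'.2 = s.2 then (Y.map fun j => s.1 - j).real {s'.1} else 0 := by
    rw [measureReal_def, Measure.map_apply Measurable.of_discrete (measurableSet_singleton _)]
    split_ifs with h
    · have : (fun m : ℕ => (m, s.2)) ⁻¹' {s'} = {s'.1} := by
        ext m; simp [Prod.ext_iff, h]
      rw [this, measureReal_def]
    · have : (fun m : ℕ => (m, s.2)) ⁻¹' {s'} = ∅ := by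
        ext m; simp [Prod.ext_iff, Ne.symm h]
      simp [this]
  have hd : (Measure.dirac (nextPhase s)).real {s'} = if s' = nextPhase s then 1 else 0 := by
    rw [measureReal_def, Measure.dirac_apply' _ (measurableSet_singleton _)]
    by_cases h : s' = nextPhase s
    · simp [h]
    · simp [h, Ne.symm h]
  have h2 : IsProbabilityMeasure ((Y.map fun j => s.1 - j).map fun m => (m, s.2)) :=
    Measure.isProbabilityMeasure_map Measurable.of_discrete.aemeasurable
  have hpos : 0 < k * lam + mu := by positivity
  have hr : (erlangStep lam mu Y k s).real {s'} = k * lam / (k * lam + mu) *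
      (if s' = nextPhase s then 1 else 0) + mu / (k * lam + mu) *
      (if s'.2 = s.2 then (Y.map fun j => s.1 - j).real {s'.1} else 0) := by
    rw [← hs, ← hd, measureReal_def, erlangStep, Measure.add_apply, Measure.smul_apply,
      Measure.smul_apply, smul_eq_mul, smul_eq_mul,
      ENNReal.toReal_add (ENNReal.mul_ne_top ENNReal.ofReal_ne_top (measure_ne_top _ _))
      (ENNReal.mul_ne_top ENNReal.ofReal_ne_top (measure_ne_top _ _)), ENNReal.toReal_mul,
      ENNReal.toReal_mul, ENNReal.toReal_ofReal (by positivity),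
      ENNReal.toReal_ofReal (by positivity)]
    rfl
  rw [hr, erlangGenerator]
  field_simp
  ring

theorem isErlangStationary_iff [IsProbabilityMeasure Y] (hlam : 0 < lam) (hmu : 0 < mu)
    (P : Measure (ℕ × Fin k)) :
    IsErlangStationary lam mu Y k P ↔ IsProbabilityMeasure P ∧
      ∀ s', P {s'} = ∑' s, P {s} * erlangStep lam mu Y k s {s'} := by
  refine and_congr_right fun hP => forall_congr' fun s' => ?_
  have hK : ∀ s, IsProbabilityMeasure (erlangStep lam mu Y k s) :=
    isProbabilityMeasure_erlangStep hlam hmu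
  have hpos : 0 < k * lam + mu := by positivity
  have hfin : ∑' s, P {s} * erlangStep lam mu Y k s {s'} ≠ ∞ := by
    refine ne_top_of_le_ne_top (b := 1) (by simp) ?_
    calc _ ≤ ∑' s, P {s} * 1 := ENNReal.tsum_le_tsum fun s => by gcongr; exact prob_le_one
      _ = 1 := by simp [measure_eq_tsum_singleton]
  have hsum : HasSum (fun s => P.real {s} * (erlangStep lam mu Y k s).real {s'})
      (∑' s, P {s} * erlangStep lam mu Y k s {s'}).toReal := by
    have := (ENNReal.summable_toReal hfin).hasSum
    rw [← ENNReal.tsum_toReal_eq (fun s => ENNReal.ne_top_of_tsum_ne_top hfin s)] at this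
    simpa only [ENNReal.toReal_mul, measureReal_def] using this
  have hone : HasSum (fun s => P.real {s} * if s' = s then 1 else 0) (P.real {s'}) := by
    convert hasSum_ite_eq s' (P.real {s'}) using 2 with s
    by_cases h : s' = s
    · subst h; simp
    · simp [h, Ne.symm h]
  have hall := (hsum.sub hone).mul_left (k * lam + mu)
  have heq : (fun s => P.real {s} * erlangGenerator lam mu Y k s s') = fun s =>
      (k * lam + mu) * (P.real {s} * (erlangStep lam mu Y k s).real {s'} -
        P.real {s} * if s' = s then 1 else 0) := by
    funext s
    rw [erlangGenerator_eq hlam hmu]; ring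
  rw [heq]
  constructor
  · intro h
    have h0 := hall.unique h
    have h1 : (∑' s, P {s} * erlangStep lam mu Y k s {s'}).toReal = P.real {s'} := by
      rcases mul_eq_zero.1 h0 with h | h <;> linarith
    rw [measureReal_def, ENNReal.toReal_eq_toReal_iff' hfin (measure_ne_top _ _)] at h1
    exact h1.symm
  · intro h
    rw [← h, measureReal_def, sub_self, mul_zero] at hall
    exact hall

/-- Numbering the states by `m * k + i` turns `nextPhase` into the successor map, whose orbits meet.
-/
theorem nextPhase_index (s : ℕ × Fin k) :
    (nextPhase s).1 * k + (nextPhase s).2 = s.1 * k + s.2 + 1 := by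
  unfold nextPhase
  split_ifs with h
  · simp; ring
  · have : (s.2 : ℕ) + 1 = k := by have := s.2.2; omega
    simp [add_mul]
    omega

theorem index_injective {s t : ℕ × Fin k} (h : s.1 * k + (s.2 : ℕ) = t.1 * k + t.2) : s = t := by
  have hk : 0 < k := s.2.pos
  have h1 : s.1 = t.1 := by
    have := congrArg (· / k) h
    simpa [Nat.add_div_of_dvd_right, add_comm, Nat.add_mul_div_right _ _ hk,
      Nat.div_eq_of_lt s.2.2, Nat.div_eq_of_lt t.2.2] using this
  refine Prod.ext h1 (Fin.ext ?_)
  rw [h1] at h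
  omega

theorem isErlangStationary_unique [IsProbabilityMeasure Y] (hlam : 0 < lam) (hmu : 0 < mu)
    {P Q : Measure (ℕ × Fin k)} (hP : IsErlangStationary lam mu Y k P)
    (hQ : IsErlangStationary lam mu Y k Q) : P = Q := by
  rw [isErlangStationary_iff hlam hmu] at hP hQ
  have := hP.1
  have := hQ.1
  have hiter : ∀ (i : ℕ) (s : ℕ × Fin k),
      (nextPhase^[i] s).1 * k + ((nextPhase^[i] s).2 : ℕ) = s.1 * k + s.2 + i := by
    intro i s
    induction i with
    | zero => simp
    | succ i ih => rw [Function.iterate_succ_apply', nextPhase_index, ih]; ring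
  refine invariant_measure_unique (erlangStep lam mu Y k) (isProbabilityMeasure_erlangStep hlam hmu)
    nextPhase (fun s => ?_) (fun s t => ⟨t.1 * k + t.2, s.1 * k + s.2, ?_⟩) P Q hP.2 hQ.2
  · have hk : 0 < (k : ℝ) := by exact_mod_cast s.2.pos
    have : 0 < k * lam / (k * lam + mu) := by positivity
    simp [erlangStep, this]
  · apply index_injective
    rw [hiter, hiter]; ring

/-- The law of a state whose phase is uniform and whose first component has law `Γ i` in phase
`i`. -/
noncomputable def phaseMixture (Γ : Fin k → Measure ℕ) : Measure (ℕ × Fin k) :=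
  ∑ i, (k : ℝ≥0∞)⁻¹ • (Γ i).map fun m => (m, i)

theorem phaseMixture_apply (Γ : Fin k → Measure ℕ) (E : Set (ℕ × Fin k)) :
    phaseMixture Γ E = ∑ i, (k : ℝ≥0∞)⁻¹ * Γ i {m | (m, i) ∈ E} := by
  simp only [phaseMixture, Measure.finsetSum_apply, Measure.smul_apply, smul_eq_mul]
  refine Finset.sum_congr rfl fun i _ => ?_
  rw [Measure.map_apply Measurable.of_discrete E.to_countable.measurableSet]
  rfl

theorem phaseMixture_prod (Γ : Fin k → Measure ℕ) (B : Set ℕ) (i : Fin k) :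
    phaseMixture Γ (B ×ˢ {i}) = (k : ℝ≥0∞)⁻¹ * Γ i B := by
  rw [phaseMixture_apply, Finset.sum_eq_single i]
  · simp
  · intro j _ hj
    simp [hj]
  · simp

theorem isProbabilityMeasure_phaseMixture (hk : 1 ≤ k) {Γ : Fin k → Measure ℕ}
    (hΓ : ∀ i, IsProbabilityMeasure (Γ i)) : IsProbabilityMeasure (phaseMixture Γ) := by
  refine ⟨?_⟩
  rw [phaseMixture_apply]
  simp only [Set.mem_univ, Set.ofPred_true, measure_univ, mul_one, Finset.sum_const,
    Finset.card_univ, Fintype.card_fin, nsmul_eq_mul]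
  exact ENNReal.mul_inv_cancel (by simp; omega) (by simp)

/-- Phase `i` is entered by an arrival phase from the preceding state, or kept by a service event,
which acts within one phase. -/
theorem phaseMixture_bind_erlangStep (Γ : Fin k → Measure ℕ) (B : Set ℕ) (i : Fin k) :
    (phaseMixture Γ).bind (erlangStep lam mu Y k) (B ×ˢ {i}) =
      ENNReal.ofReal (k * lam / (k * lam + mu)) * phaseMixture Γ (nextPhase ⁻¹' (B ×ˢ {i})) +
      ENNReal.ofReal (mu / (k * lam + mu)) *
        ((k : ℝ≥0∞)⁻¹ * ((Γ i).bind fun n => Y.map fun j => n - j) B) := by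
  have hE : MeasurableSet (B ×ˢ {i} : Set (ℕ × Fin k)) := (Set.to_countable _).measurableSet
  rw [Measure.bind_apply hE Measurable.of_discrete.aemeasurable]
  simp only [erlangStep, Measure.add_apply, Measure.smul_apply, smul_eq_mul]
  rw [lintegral_add_left Measurable.of_discrete, lintegral_const_mul _ Measurable.of_discrete,
    lintegral_const_mul _ Measurable.of_discrete]
  congr 2
  · simp_rw [Measure.dirac_apply' _ hE]
    rw [← lintegral_indicator_one (Set.to_countable _).measurableSet]
    rfl
  · rw [phaseMixture, lintegral_finsetSum_measure, Finset.sum_eq_single i]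
    · rw [lintegral_smul_measure, lintegral_map Measurable.of_discrete Measurable.of_discrete,
        Measure.bind_apply (Set.to_countable _).measurableSet Measurable.of_discrete.aemeasurable]
      congr 1
      refine lintegral_congr fun m => ?_
      rw [Measure.map_apply Measurable.of_discrete hE]
      congr 1
      ext; simp
    · intro j _ hj
      rw [lintegral_smul_measure, lintegral_map Measurable.of_discrete Measurable.of_discrete]
      have : ∀ m : ℕ, ((Y.map fun l => m - l).map fun m' => (m', j)) (B ×ˢ {i}) = 0 := by
        intro m
        rw [Measure.map_apply Measurable.of_discrete hE]
        have : (fun m' => (m', j)) ⁻¹' (B ×ˢ {i}) = (∅ : Set ℕ) := by ext; simp [hj]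
        rw [this, measure_empty]
      simp [this]
    · simp

theorem nextPhase_preimage_of_pos (B : Set ℕ) (i : ℕ) (hi : i + 1 < k) :
    nextPhase ⁻¹' (B ×ˢ {(⟨i + 1, hi⟩ : Fin k)}) = B ×ˢ {(⟨i, by omega⟩ : Fin k)} := by
  ext ⟨m, j⟩
  simp only [nextPhase, Set.mem_preimage, Set.mem_prod, Set.mem_singleton_iff]
  split_ifs with h
  · simp [Fin.ext_iff]
  · simp [Fin.ext_iff]; omega

theorem nextPhase_preimage_zero (B : Set ℕ) (hk : 0 < k) :
    nextPhase ⁻¹' (B ×ˢ {(⟨0, hk⟩ : Fin k)}) =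
      {m | m + 1 ∈ B} ×ˢ {(⟨k - 1, by omega⟩ : Fin k)} := by
  ext ⟨m, j⟩
  simp only [nextPhase, Set.mem_preimage, Set.mem_prod, Set.mem_singleton_iff]
  split_ifs with h
  · simp [Fin.ext_iff]; omega
  · have : (j : ℕ) = k - 1 := by have := j.2; omega
    simp [Fin.ext_iff, this]

theorem exists_isGeomTail {s : ℝ≥0∞} {α : Measure ℕ} (hα : IsGeomTail s s α) {q : ℝ≥0∞}
    (hq : q ≤ 1) : ∃ p, IsGeomTail s q p := by
  have h1 := hα.succ
  have := h1.1
  -- An atom at `0` scales the tail of first term `1` down to first term `q`.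
  refine ⟨(1 - q) • Measure.dirac 0 + q • α.map (fun m => m + 1), ⟨?_⟩, fun M => ?_⟩
  · simp [tsub_add_cancel_of_le hq]
  · simp only [Measure.add_apply, Measure.smul_apply, h1.2]
    simp

/-- The stationary law of the queue with Erlang arrivals: given the phase `i`, the number of
customers has a geometric tail with first term `x ^ (i + 1)`. -/
theorem exists_isErlangStationary [IsProbabilityMeasure Y] (hlam : 0 < lam) (hmu : 0 < mu)
    (hk : 1 ≤ k) {s g x : ℝ} (hx0 : 0 < x) {α : Measure ℕ}
    (hα : IsGeomTail (ENNReal.ofReal s) (ENNReal.ofReal s) α)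
    (hg0 : 0 ≤ g) (hg1 : g ≤ 1) (hg : ∫⁻ j, ENNReal.ofReal s ^ j ∂Y = ENNReal.ofReal g)
    (hx : x * (k * lam + mu * (1 - g)) = k * lam) (hxk : x ^ k = s) :
    ∃ P, IsErlangStationary lam mu Y k P ∧
      IsGeomTail (ENNReal.ofReal s)
        (ENNReal.ofReal ((∑ i ∈ Finset.range k, x ^ (i + 1)) / k)) (numberLaw P) := by
  have hkpos : 0 < (k : ℝ) := by exact_mod_cast hk
  have hs0 : 0 < s := hxk ▸ pow_pos hx0 k
  have hc : 0 < k * lam + mu := by positivity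
  have hx1 : x ≤ 1 := by
    have : 0 ≤ mu * (1 - g) := mul_nonneg hmu.le (by linarith)
    by_contra h
    push Not at h
    nlinarith [mul_pos hkpos hlam]
  have hkinv : (k : ℝ≥0∞)⁻¹ = ENNReal.ofReal (k : ℝ)⁻¹ := by
    rw [ENNReal.ofReal_inv_of_pos hkpos, ENNReal.ofReal_natCast]
  choose Γ hΓ using fun i : Fin k => exists_isGeomTail hα (q := ENNReal.ofReal (x ^ ((i : ℕ) + 1)))
    (by rw [← ENNReal.ofReal_one]; exact ENNReal.ofReal_le_ofReal (pow_le_one₀ hx0.le hx1))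
  have hprob := isProbabilityMeasure_phaseMixture hk fun i => (hΓ i).1
  have hK : ∀ t, IsProbabilityMeasure (erlangStep lam mu Y k t) :=
    isProbabilityMeasure_erlangStep hlam hmu
  -- The inflow into phase `i` carries one factor `x` less. Into phase `0` it comes from phase `k -
  -- 1` with one customer added, and `x ^ k = s` makes the formula the same.
  have htail : ∀ (M : ℕ) (i : Fin k), phaseMixture Γ (nextPhase ⁻¹' (Set.Ici (M + 1) ×ˢ {i})) =
      ENNReal.ofReal ((k : ℝ)⁻¹ * (x ^ (i : ℕ) * s ^ M)) := by
    rintro M ⟨i, hi⟩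
    cases i with
    | zero =>
      rw [nextPhase_preimage_zero, phaseMixture_prod, hkinv, ENNReal.ofReal_mul (by positivity)]
      congr 1
      have : {m | m + 1 ∈ Set.Ici (M + 1)} = Set.Ici M := by ext; simp
      rw [this]
      cases M with
      | zero => have := (hΓ ⟨k - 1, by omega⟩).1; simp
      | succ M =>
        rw [(hΓ _).2, ← ENNReal.ofReal_pow hs0.le, ← ENNReal.ofReal_mul (by positivity)]
        simp only [Nat.sub_add_cancel hk, hxk]
        congr 1; ring
    | succ i =>
      rw [nextPhase_preimage_of_pos, phaseMixture_prod, hkinv, (hΓ _).2,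
        ← ENNReal.ofReal_pow hs0.le, ← ENNReal.ofReal_mul (by positivity),
        ← ENNReal.ofReal_mul (by positivity)]
  have htail0 : ∀ i : Fin k, phaseMixture Γ (nextPhase ⁻¹' (Set.univ ×ˢ {i})) =
      ENNReal.ofReal (k : ℝ)⁻¹ := by
    rintro ⟨i, hi⟩
    cases i with
    | zero =>
      have := (hΓ ⟨k - 1, by omega⟩).1
      rw [nextPhase_preimage_zero, phaseMixture_prod, hkinv]
      simp
    | succ i =>
      have := (hΓ ⟨i, by omega⟩).1
      rw [nextPhase_preimage_of_pos, phaseMixture_prod, hkinv]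
      simp
  refine ⟨phaseMixture Γ, (isErlangStationary_iff hlam hmu _).2 ⟨hprob, ?_⟩, ?_, ?_⟩
  · rintro ⟨m, i⟩
    have hbp : IsProbabilityMeasure ((phaseMixture Γ).bind (erlangStep lam mu Y k)) :=
      isProbabilityMeasure_bind _ Measurable.of_discrete (ae_of_all _ hK)
    have hslice : ∀ (ν : Measure (ℕ × Fin k)) (B : Set ℕ),
        ((ν.restrict (Set.univ ×ˢ {i})).map Prod.fst) B = ν (B ×ˢ {i}) := by
      intro ν B
      rw [Measure.map_apply Measurable.of_discrete (Set.to_countable _).measurableSet,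
        Measure.restrict_apply (Set.to_countable _).measurableSet]
      congr 1
      ext; simp
    have hsl : ((phaseMixture Γ).restrict (Set.univ ×ˢ {i})).map Prod.fst =
        (((phaseMixture Γ).bind (erlangStep lam mu Y k)).restrict (Set.univ ×ˢ {i})).map
          Prod.fst := by
      refine ext_of_tail fun M => ?_
      rw [hslice, hslice, phaseMixture_bind_erlangStep, phaseMixture_prod, hkinv]
      have hsv := (hΓ i).serve Y
      rw [hg] at hsv
      cases M with
      | zero =>
        have h1 := (hΓ i).1
        have h2 := hsv.1
        have h0 : Set.Ici 0 = (Set.univ : Set ℕ) := by ext; simp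
        rw [h0, htail0, measure_univ, measure_univ, mul_one, ← ENNReal.ofReal_mul (by positivity),
          ← ENNReal.ofReal_mul (by positivity), ← ENNReal.ofReal_add (by positivity)
          (by positivity)]
        congr 1
        field_simp
      | succ M =>
        rw [htail, (hΓ i).2, hsv.2, ← ENNReal.ofReal_pow hs0.le]
        repeat rw [← ENNReal.ofReal_mul (by positivity)]
        rw [← ENNReal.ofReal_add (by positivity) (by positivity)]
        congr 1
        field_simp
        rw [pow_succ]
        -- The balance of the tails in phase `i` is `x ^ i` times the equation `hx` for one phase.
        linear_combination (x ^ (i : ℕ)) * hx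
    have := congrArg (fun ν => ν {m}) hsl
    simp only [hslice] at this
    rw [bind_apply_singleton _ _ (Set.to_countable _).measurableSet] at this
    simpa using this
  · exact Measure.isProbabilityMeasure_map Measurable.of_discrete.aemeasurable
  · intro M
    rw [numberLaw, Measure.map_apply Measurable.of_discrete (Set.to_countable _).measurableSet,
      phaseMixture_apply]
    have : ∀ i : Fin k, {m : ℕ | (m, i) ∈ (Prod.fst : ℕ × Fin k → ℕ) ⁻¹' Set.Ici (M + 1)} =
        Set.Ici (M + 1) := by intro i; ext; simp
    simp_rw [this, fun i => (hΓ i).2 M, hkinv, ← ENNReal.ofReal_pow hs0.le]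
    rw [Finset.sum_div, ENNReal.ofReal_sum_of_nonneg fun i _ => by positivity, Finset.sum_mul,
      ← Fin.sum_univ_eq_sum_range
        (fun i => ENNReal.ofReal (x ^ (i + 1) / k) * ENNReal.ofReal (s ^ M)) k]
    refine Finset.sum_congr rfl fun i _ => ?_
    rw [← mul_assoc, ← ENNReal.ofReal_mul (by positivity)]
    congr 2
    rw [div_eq_inv_mul]

end Erlang

/-! ### The queue with deterministic arrivals -/

section Deterministic

variable {mu : ℝ} {Y : Measure ℕ} {T : ℝ}

/-- The uniform distribution on `[0, T)`. -/
noncomputable def uniformAge (T : ℝ) : Measure ℝ :=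
  ENNReal.ofReal T⁻¹ • (volume.restrict (Set.Ico 0 T))

theorem isProbabilityMeasure_uniformAge (hT : 0 < T) : IsProbabilityMeasure (uniformAge T) := by
  refine ⟨?_⟩
  rw [uniformAge, Measure.smul_apply, Measure.restrict_apply_univ, Real.volume_Ico, smul_eq_mul,
    ← ENNReal.ofReal_mul (by positivity), sub_zero, inv_mul_cancel₀ hT.ne', ENNReal.ofReal_one]

theorem ae_uniformAge : ∀ᵐ a ∂(uniformAge T), a ∈ Set.Ico 0 T :=
  Measure.ae_smul_measure (ae_restrict_mem measurableSet_Ico) _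

theorem age_mem_Ico (hT : 0 < T) {x : ℝ} (hx : 0 ≤ x) : x - ⌊x / T⌋₊ * T ∈ Set.Ico 0 T := by
  have h0 : 0 ≤ x / T := by positivity
  have h1 := Nat.floor_le h0
  have h2 := Nat.lt_floor_add_one (x / T)
  rw [le_div_iff₀ hT] at h1
  rw [div_lt_iff₀ hT] at h2
  constructor <;> linarith

theorem floor_div_eq_zero (hT : 0 < T) {a : ℝ} (ha : a ∈ Set.Ico 0 T) : ⌊a / T⌋₊ = 0 := by
  rw [Nat.floor_eq_zero, div_lt_one hT]
  exact ha.2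

theorem measurable_age (T t : ℝ) : Measurable fun a : ℝ => a + t - ⌊(a + t) / T⌋₊ * T := by
  have : Measurable fun a : ℝ => ⌊(a + t) / T⌋₊ := Nat.measurable_floor.comp (by fun_prop)
  have h2 : Measurable fun a : ℝ => (⌊(a + t) / T⌋₊ : ℝ) := measurable_from_nat.comp this
  fun_prop

/-- The uniform distribution is invariant under the rotations of the circle of length `T`. -/
theorem lintegral_uniformAge_rotate (hT : 0 < T) {c : ℝ} (hc : 0 ≤ c) (f : ℝ → ℝ≥0∞) :
    ∫⁻ a, f (a + c - ⌊(a + c) / T⌋₊ * T) ∂(uniformAge T) = ∫⁻ a, f a ∂(uniformAge T) := by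
  have : Fact (0 < T) := ⟨hT⟩
  -- On the circle the shift is a translation, which preserves the Haar measure.
  set F : AddCircle T → ℝ≥0∞ := fun b => f (AddCircle.equivIco T 0 b) with hF
  have hval : ∀ x : ℝ, 0 ≤ x → F (x : AddCircle T) = f (x - ⌊x / T⌋₊ * T) := by
    intro x hx
    simp only [hF]
    congr 1
    rw [AddCircle.coe_equivIco_mk_apply, Int.fract, sub_mul, div_mul_cancel₀ _ hT.ne',
      natCast_floor_eq_intCast_floor (by positivity)]
  have hgen : ∀ c : ℝ, 0 ≤ c →
      ∫⁻ a in Set.Ico 0 T, f (a + c - ⌊(a + c) / T⌋₊ * T) = ∫⁻ b, F b := by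
    intro c hc
    calc ∫⁻ a in Set.Ico 0 T, f (a + c - ⌊(a + c) / T⌋₊ * T)
        = ∫⁻ a in Set.Ico 0 T, F ((a : AddCircle T) + (c : AddCircle T)) := by
          refine setLIntegral_congr_fun measurableSet_Ico fun a ha => ?_
          rw [← hval _ (add_nonneg ha.1 hc), AddCircle.coe_add]
      _ = ∫⁻ a in Set.Ioc 0 (0 + T), F ((a : AddCircle T) + (c : AddCircle T)) := by
          rw [zero_add, Measure.restrict_congr_set Ico_ae_eq_Ioc]
      _ = ∫⁻ b, F (b + (c : AddCircle T)) :=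
          AddCircle.lintegral_preimage T 0 (fun b => F (b + (c : AddCircle T)))
      _ = ∫⁻ b, F b := lintegral_add_right_eq_self _ _
  rw [uniformAge, lintegral_smul_measure, lintegral_smul_measure, hgen c hc, ← hgen 0 le_rfl]
  congr 1
  refine setLIntegral_congr_fun measurableSet_Ico fun a ha => ?_
  simp [floor_div_eq_zero hT ha]

theorem measurable_bind_param {β : Type*} [MeasurableSpace β] {R : Type*} [MeasurableSpace R]
    {p : β → Measure ℕ} (hp : Measurable p) {f : β → ℕ → Measure R}
    (hf : ∀ n, Measurable fun b => f b n) : Measurable fun b => (p b).bind (f b) := by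
  refine Measure.measurable_of_measurable_coe _ fun B hB => ?_
  simp_rw [bind_apply_singleton _ _ hB]
  exact Measurable.tsum fun n => ((Measure.measurable_coe (measurableSet_singleton n)).comp hp).mul
    ((Measure.measurable_coe hB).comp (hf n))

theorem measurable_afterArrival (i : ℕ) :
    Measurable fun s : ℕ × ℝ => afterArrival mu Y T s.1 s.2 i := by
  induction i with
  | zero =>
    refine measurable_from_prod_countable_right fun n => ?_
    exact (Measure.measurable_map _ Measurable.of_discrete).comp
      ((measurable_afterService n).comp (by fun_prop))
  | succ i ih => exact measurable_bind_param ih fun n => measurable_const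

theorem measurable_numberAt (t : ℝ) (i : ℕ) :
    Measurable fun s : ℕ × ℝ => numberAt mu Y T t s.1 s.2 i := by
  cases i with
  | zero =>
    simp only [numberAt]
    exact measurable_from_prod_countable_right fun n =>
      (measurable_const : Measurable fun _ : ℝ => afterService mu Y n t)
  | succ i =>
    exact measurable_bind_param (measurable_afterArrival i) fun n =>
      (measurable_afterService n).comp (by fun_prop)

theorem deterministicTransition_eq (t : ℝ) (s : ℕ × ℝ) :
    deterministicTransition mu Y T t s = (numberAt mu Y T t s.1 s.2 ⌊(s.2 + t) / T⌋₊).bind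
      fun m => Measure.dirac (m, s.2 + t - ⌊(s.2 + t) / T⌋₊ * T) := by
  rw [Measure.bind_dirac_eq_map _ Measurable.of_discrete]
  rfl

theorem measurable_deterministicTransition (t : ℝ) :
    Measurable (deterministicTransition mu Y T t) := by
  have h : deterministicTransition mu Y T t = fun s =>
    (numberAt mu Y T t s.1 s.2 ⌊(s.2 + t) / T⌋₊).bind
      fun m => Measure.dirac (m, s.2 + t - ⌊(s.2 + t) / T⌋₊ * T) :=
    funext (deterministicTransition_eq t)
  rw [h]
  refine measurable_bind_param ?_ fun m => ?_
  · have hi : Measurable fun s : ℕ × ℝ => ⌊(s.2 + t) / T⌋₊ :=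
      Nat.measurable_floor.comp (by fun_prop)
    have hall : Measurable fun x : ℕ × (ℕ × ℝ) => numberAt mu Y T t x.2.1 x.2.2 x.1 :=
      measurable_from_prod_countable_right fun i => measurable_numberAt t i
    exact hall.comp (hi.prodMk measurable_id)
  · exact Measure.measurable_dirac.comp
      (measurable_const.prodMk ((measurable_age T t).comp measurable_snd))

theorem isProbabilityMeasure_afterArrival [IsProbabilityMeasure Y] (n : ℕ) (a : ℝ) (i : ℕ) :
    IsProbabilityMeasure (afterArrival mu Y T n a i) := by
  induction i with
  | zero => exact Measure.isProbabilityMeasure_map Measurable.of_discrete.aemeasurable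
  | succ i ih =>
    exact isProbabilityMeasure_bind _ Measurable.of_discrete (ae_of_all _ fun m =>
      Measure.isProbabilityMeasure_map Measurable.of_discrete.aemeasurable)

theorem isProbabilityMeasure_numberAt [IsProbabilityMeasure Y] (t : ℝ) (n : ℕ) (a : ℝ) (i : ℕ) :
    IsProbabilityMeasure (numberAt mu Y T t n a i) := by
  cases i with
  | zero => rw [numberAt]; infer_instance
  | succ i =>
    have := isProbabilityMeasure_afterArrival (mu := mu) (Y := Y) (T := T) n a i
    exact isProbabilityMeasure_bind _ Measurable.of_discrete (ae_of_all _ fun m => inferInstance)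

/-! ### Existence for deterministic arrivals -/

section Existence

variable {z : ℝ≥0∞} {g : ℝ}

/-- From age `a` the first term decays to `z` when age `T` is reached, by `hz`, and the arrival
resets it to `1`. Each further period repeats this. -/
theorem IsGeomTail.afterArrival [IsProbabilityMeasure Y] (hg0 : 0 ≤ g)
    (hg : ∫⁻ s, z ^ s ∂Y = ENNReal.ofReal g) (hmu : 0 < mu) (hT : 0 < T)
    (hz : ENNReal.ofReal (Real.exp (-(mu * (1 - g) * T))) = z) {a : ℝ} (ha : a ≤ T)
    {p : Measure ℕ} (hp : IsGeomTail z (ENNReal.ofReal (Real.exp (-(mu * (1 - g) * a)))) p)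
    (i : ℕ) : IsGeomTail z 1 (p.bind fun n => BatchQueue.afterArrival mu Y T n a i) := by
  have hmap : ∀ (q : Measure ℕ) (f : ℕ → Measure ℕ),
      (q.bind fun n => (f n).map fun m => m + 1) = (q.bind f).map fun m => m + 1 := by
    intro q f
    simp_rw [← Measure.bind_dirac_eq_map _ (Measurable.of_discrete (f := fun m : ℕ => m + 1))]
    rw [Measure.bind_bind Measurable.of_discrete.aemeasurable
      Measurable.of_discrete.aemeasurable]
  induction i with
  | zero =>
    simp only [BatchQueue.afterArrival]
    rw [hmap]
    refine IsGeomTail.succ ?_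
    have := hp.afterService (mu := mu) hg0 hg hmu (sub_nonneg.2 ha)
    rwa [← ENNReal.ofReal_mul (Real.exp_pos _).le, ← Real.exp_add,
      show -(mu * (1 - g) * a) + -(mu * (1 - g) * (T - a)) = -(mu * (1 - g) * T) by ring, hz]
      at this
  | succ i ih =>
    simp only [BatchQueue.afterArrival]
    rw [← Measure.bind_bind Measurable.of_discrete.aemeasurable
      Measurable.of_discrete.aemeasurable, hmap]
    refine IsGeomTail.succ ?_
    have := ih.afterService (mu := mu) hg0 hg hmu hT.le
    rwa [one_mul, hz] at this

/-- As every arrival resets the first term, the law at time `t` depends only on the new age `a + t -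
i * T`. -/
theorem IsGeomTail.numberAt [IsProbabilityMeasure Y] (hg0 : 0 ≤ g)
    (hg : ∫⁻ s, z ^ s ∂Y = ENNReal.ofReal g) (hmu : 0 < mu) (hT : 0 < T)
    (hz : ENNReal.ofReal (Real.exp (-(mu * (1 - g) * T))) = z) {a t : ℝ} (ha : a ≤ T) (ht : 0 ≤ t)
    {p : Measure ℕ} (hp : IsGeomTail z (ENNReal.ofReal (Real.exp (-(mu * (1 - g) * a)))) p)
    {i : ℕ} (hi : i * T ≤ a + t) :
    IsGeomTail z (ENNReal.ofReal (Real.exp (-(mu * (1 - g) * (a + t - i * T)))))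
      (p.bind fun n => BatchQueue.numberAt mu Y T t n a i) := by
  cases i with
  | zero =>
    have := hp.afterService (mu := mu) hg0 hg hmu ht
    rw [← ENNReal.ofReal_mul (Real.exp_pos _).le, ← Real.exp_add] at this
    simp only [BatchQueue.numberAt]
    convert this using 3
    push_cast
    ring
  | succ i =>
    simp only [BatchQueue.numberAt]
    rw [← Measure.bind_bind Measurable.of_discrete.aemeasurable
      Measurable.of_discrete.aemeasurable]
    have := (hp.afterArrival hg0 hg hmu hT hz ha i).afterService (mu := mu) hg0 hg hmu
      (t := a + t - (i + 1) * T) (by push_cast at hi; linarith)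
    rw [one_mul] at this
    push_cast
    exact this

/-- The stationary law of the queue with deterministic arrivals: the time since the last arrival is
uniform, and when it is `a` the number of customers has a geometric tail with first term
`exp (-mu * (1 - g) * a)`. -/
theorem exists_isDeterministicStationary [IsProbabilityMeasure Y] (hg0 : 0 ≤ g)
    (hg : ∫⁻ s, z ^ s ∂Y = ENNReal.ofReal g) (hmu : 0 < mu) (hT : 0 < T)
    (hz : ENNReal.ofReal (Real.exp (-(mu * (1 - g) * T))) = z) {α : Measure ℕ}
    (hα : IsGeomTail z z α) :
    ∃ P, IsDeterministicStationary mu Y T P ∧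
      IsGeomTail z (∫⁻ a, ENNReal.ofReal (Real.exp (-(mu * (1 - g) * a))) ∂(uniformAge T))
        (numberLaw P) := by
  have hU := isProbabilityMeasure_uniformAge hT
  set Φ : ℝ → Measure ℕ := fun a =>
    (α.map fun m => m + 1).bind fun n => BatchQueue.afterService mu Y n a with hΦ
  have hΦm : Measurable Φ := measurable_bind_param measurable_const measurable_afterService
  have hΦg : ∀ a, 0 ≤ a → IsGeomTail z (ENNReal.ofReal (Real.exp (-(mu * (1 - g) * a)))) (Φ a) := by
    intro a ha
    have := hα.succ.afterService (mu := mu) hg0 hg hmu ha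
    rwa [one_mul] at this
  set J : ℝ → Measure (ℕ × ℝ) := fun a => (Φ a).bind fun m => Measure.dirac (m, a) with hJ
  have hJm : Measurable J := measurable_bind_param hΦm fun n => by fun_prop
  have hJapp : ∀ a B, MeasurableSet B → J a B = Φ a {m | (m, a) ∈ B} := by
    intro a B hB
    simp only [hJ]
    rw [Measure.bind_dirac_eq_map _ Measurable.of_discrete,
      Measure.map_apply Measurable.of_discrete hB]
    rfl
  have hJp : ∀ a, 0 ≤ a → IsProbabilityMeasure (J a) := by
    intro a ha
    have := (hΦg a ha).1
    exact isProbabilityMeasure_bind _ Measurable.of_discrete (ae_of_all _ fun _ => inferInstance)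
  have hPapp : ∀ B, MeasurableSet B →
      (uniformAge T).bind J B = ∫⁻ a, Φ a {m | (m, a) ∈ B} ∂(uniformAge T) := by
    intro B hB
    rw [Measure.bind_apply hB hJm.aemeasurable]
    exact lintegral_congr fun a => hJapp a B hB
  refine ⟨(uniformAge T).bind J, ⟨?_, ?_, ?_⟩, ?_⟩
  · exact isProbabilityMeasure_bind _ hJm (ae_uniformAge.mono fun a ha => hJp a ha.1)
  · have hm : MeasurableSet {s : ℕ × ℝ | s.2 ∈ Set.Ico 0 T} := measurable_snd measurableSet_Ico
    rw [ae_iff, ← Set.compl_ofPred, hPapp _ hm.compl,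
      lintegral_congr_ae (g := fun _ => 0) (ae_uniformAge.mono fun a ha => ?_), lintegral_zero]
    simp only
    convert measure_empty (μ := Φ a)
    ext m
    simpa using ha
  · intro t ht B hB
    have hmeas : Measurable fun s => deterministicTransition mu Y T t s B :=
      (Measure.measurable_coe hB).comp (measurable_deterministicTransition t)
    rw [Measure.lintegral_bind hJm.aemeasurable hmeas.aemeasurable, hPapp B hB,
      ← lintegral_uniformAge_rotate hT ht fun a => Φ a {m | (m, a) ∈ B}]
    refine lintegral_congr_ae (ae_uniformAge.mono fun a ha => ?_)
    have hat : 0 ≤ a + t := add_nonneg ha.1 ht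
    have hmem := age_mem_Ico hT hat
    have h1 := (hΦg a ha.1).numberAt hg0 hg hmu hT hz ha.2.le ht
      (i := ⌊(a + t) / T⌋₊) (by linarith [hmem.1])
    simp only [hJ]
    rw [Measure.bind_dirac_eq_map _ Measurable.of_discrete,
      lintegral_map hmeas Measurable.of_discrete, ← h1.unique (hΦg _ hmem.1),
      Measure.bind_apply (Set.to_countable _).measurableSet Measurable.of_discrete.aemeasurable]
    refine lintegral_congr fun n => ?_
    rw [deterministicTransition, Measure.map_apply Measurable.of_discrete hB]
    rfl
  · have : numberLaw ((uniformAge T).bind J) = (uniformAge T).bind Φ := by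
      refine Measure.ext fun B hB => ?_
      rw [numberLaw, Measure.map_apply measurable_fst hB, hPapp _ (measurable_fst hB),
        Measure.bind_apply hB hΦm.aemeasurable]
      rfl
    rw [this]
    exact IsGeomTail.mix _ hΦm (by fun_prop) (ae_uniformAge.mono fun a ha => hΦg a ha.1)

end Existence

/-! ### Uniqueness for deterministic arrivals -/

/-- In equilibrium the time since the last arrival is uniform. -/
theorem IsDeterministicStationary.map_snd [IsProbabilityMeasure Y] (hT : 0 < T)
    {P : Measure (ℕ × ℝ)} (h : IsDeterministicStationary mu Y T P) :
    P.map Prod.snd = uniformAge T := by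
  obtain ⟨hP, hmem, hinv⟩ := h
  have hU := isProbabilityMeasure_uniformAge hT
  refine Measure.ext fun B hB => ?_
  have hrot : ∀ t, 0 ≤ t → ∫⁻ s, B.indicator 1 (s.2 + t - ⌊(s.2 + t) / T⌋₊ * T) ∂P
      = P.map Prod.snd B := by
    intro t ht
    rw [Measure.map_apply measurable_snd hB, ← hinv t ht _ (measurable_snd hB)]
    refine lintegral_congr fun s => ?_
    have := isProbabilityMeasure_numberAt (mu := mu) (Y := Y) (T := T) t s.1 s.2 ⌊(s.2 + t) / T⌋₊
    rw [deterministicTransition, Measure.map_apply Measurable.of_discrete (measurable_snd hB)]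
    by_cases hb : s.2 + t - ⌊(s.2 + t) / T⌋₊ * T ∈ B
    · simp [hb, Set.preimage]
    · simp [hb, Set.preimage]
  -- Invariance is averaged over a uniform time `t`. After exchanging the integrals, a uniform shift
  -- of any fixed age is uniform.
  have h1 : ∫⁻ t, (∫⁻ s, B.indicator 1 (s.2 + t - ⌊(s.2 + t) / T⌋₊ * T) ∂P) ∂(uniformAge T)
      = P.map Prod.snd B := by
    rw [lintegral_congr_ae (ae_uniformAge.mono fun t ht => hrot t ht.1)]
    simp
  have hm : Measurable fun x : ℝ × (ℕ × ℝ) =>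
      B.indicator (1 : ℝ → ℝ≥0∞) (x.2.2 + x.1 - ⌊(x.2.2 + x.1) / T⌋₊ * T) := by
    refine (measurable_one.indicator hB).comp ?_
    exact (by simpa using measurable_age T 0 : Measurable fun a : ℝ => a - ⌊a / T⌋₊ * T).comp
      (by fun_prop : Measurable fun x : ℝ × (ℕ × ℝ) => x.2.2 + x.1)
  rw [← h1, lintegral_lintegral_swap hm.aemeasurable]
  have h2 : ∀ᵐ s ∂P, ∫⁻ t, B.indicator 1 (s.2 + t - ⌊(s.2 + t) / T⌋₊ * T) ∂(uniformAge T)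
      = uniformAge T B := by
    refine hmem.mono fun s hs => ?_
    have := lintegral_uniformAge_rotate hT hs.1 (B.indicator 1)
    rw [lintegral_indicator_one hB] at this
    rw [← this]
    simp_rw [add_comm s.2]
  rw [lintegral_congr_ae h2]
  simp

theorem floor_add_period (hT : 0 < T) {a : ℝ} (ha : a ∈ Set.Ico 0 T) : ⌊(a + T) / T⌋₊ = 1 := by
  rw [add_div, div_self hT.ne', Nat.floor_add_one (div_nonneg ha.1 hT.le), floor_div_eq_zero hT ha]

theorem measurable_numberAt_right (t : ℝ) (i n : ℕ) :
    Measurable fun a : ℝ => BatchQueue.numberAt mu Y T t n a i := by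
  have h : Measurable fun a : ℝ => (n, a) := by fun_prop
  exact Measurable.comp (g := fun s : ℕ × ℝ => BatchQueue.numberAt mu Y T t s.1 s.2 i)
    (measurable_numberAt t i) h

theorem exists_periodKernel [IsProbabilityMeasure Y] (T : ℝ) (κ : Kernel ℝ ℕ) [IsMarkovKernel κ] :
    ∃ η : Kernel ℝ ℕ, IsMarkovKernel η ∧ ∀ a, η a =
      (κ a).bind fun n => BatchQueue.numberAt mu Y T T n a 1 := by
  have hm : Measurable fun a => (κ a).bind fun n => BatchQueue.numberAt mu Y T T n a 1 :=
    measurable_bind_param κ.measurable fun n => measurable_numberAt_right T 1 n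
  refine ⟨⟨_, hm⟩, ⟨fun a => ?_⟩, fun a => rfl⟩
  exact isProbabilityMeasure_bind _ Measurable.of_discrete
    (ae_of_all _ fun n => isProbabilityMeasure_numberAt _ _ _ _)

/-- In equilibrium the law of the number of customers given the time `a` since the last arrival is
invariant for the number of customers observed once per inter-arrival time. -/
theorem IsDeterministicStationary.exists_kernel [IsProbabilityMeasure Y] (hT : 0 < T)
    {P : Measure (ℕ × ℝ)} (h : IsDeterministicStationary mu Y T P) :
    ∃ κ : Kernel ℝ ℕ, IsMarkovKernel κ ∧ P.map Prod.swap = uniformAge T ⊗ₘ κ ∧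
      ∀ᵐ a ∂(uniformAge T), κ a = (κ a).bind fun n => BatchQueue.numberAt mu Y T T n a 1 := by
  have hsnd := h.map_snd hT
  obtain ⟨hP, hmem, hinv⟩ := h
  have hU := isProbabilityMeasure_uniformAge hT
  have hPs : IsProbabilityMeasure (P.map Prod.swap) :=
    Measure.isProbabilityMeasure_map measurable_swap.aemeasurable
  obtain ⟨κ, hκ, hdis⟩ : ∃ κ : Kernel ℝ ℕ, IsMarkovKernel κ ∧
      P.map Prod.swap = uniformAge T ⊗ₘ κ := by
    refine ⟨(P.map Prod.swap).condKernel, inferInstance, ?_⟩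
    have := Measure.disintegrate (P.map Prod.swap) (P.map Prod.swap).condKernel
    rw [Measure.fst_map_swap, Measure.snd, hsnd] at this
    exact this.symm
  obtain ⟨η, hη, hηa⟩ := exists_periodKernel (mu := mu) (Y := Y) T κ
  refine ⟨κ, inferInstance, hdis, ?_⟩
  simp_rw [← hηa]
  -- A full period returns the age to itself, so invariance at time `T` acts fibrewise, and a
  -- disintegration is almost everywhere unique.
  refine Kernel.ae_eq_of_compProd_eq (Measure.ext fun E hE => ?_)
  have hEs : MeasurableSet (Prod.swap ⁻¹' E : Set (ℕ × ℝ)) := measurable_swap hE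
  rw [← hdis, Measure.map_apply measurable_swap hE, ← hinv T hT.le _ hEs,
    Measure.compProd_apply hE]
  have hPd : P = (uniformAge T ⊗ₘ κ).map Prod.swap := by
    rw [← hdis, Measure.map_map measurable_swap measurable_swap]
    simp
  have hmeas : Measurable fun s => deterministicTransition mu Y T T s (Prod.swap ⁻¹' E) :=
    (Measure.measurable_coe hEs).comp (measurable_deterministicTransition T)
  conv_lhs => rw [hPd]
  have hmeas2 : Measurable fun s : ℝ × ℕ =>
      deterministicTransition mu Y T T s.swap (Prod.swap ⁻¹' E) := hmeas.comp measurable_swap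
  rw [lintegral_map hmeas measurable_swap, Measure.lintegral_compProd hmeas2]
  refine lintegral_congr_ae (ae_uniformAge.mono fun a ha => ?_)
  simp only [Prod.swap_prod_mk]
  rw [hηa, Measure.bind_apply (Set.to_countable _).measurableSet Measurable.of_discrete.aemeasurable]
  refine lintegral_congr fun n => ?_
  simp only [deterministicTransition]
  rw [Measure.map_apply Measurable.of_discrete hEs, floor_add_period hT ha]
  congr 1
  ext m
  simp

theorem afterService_map_succ_ne_zero (n : ℕ) (t : ℝ) :
    (afterService mu Y n t).map (fun m => m + 1) {n + 1} ≠ 0 := by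
  rw [Measure.map_apply Measurable.of_discrete (measurableSet_singleton _)]
  refine fun h => afterService_self_ne_zero (mu := mu) (Y := Y) n t (measure_mono_null ?_ h)
  simp

/-- Both laws have uniform age. For almost every age the conditional laws are invariant for the same
chain of one period, in which `n ↦ n + 1` is possible. -/
theorem isDeterministicStationary_unique [IsProbabilityMeasure Y] (hT : 0 < T)
    {P Q : Measure (ℕ × ℝ)} (hP : IsDeterministicStationary mu Y T P)
    (hQ : IsDeterministicStationary mu Y T Q) : P = Q := by
  obtain ⟨κ, hκ, hPκ, hκi⟩ := hP.exists_kernel hT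
  obtain ⟨η, hη, hQη, hηi⟩ := hQ.exists_kernel hT
  have hU := isProbabilityMeasure_uniformAge hT
  have heq : ∀ᵐ a ∂(uniformAge T), κ a = η a := by
    filter_upwards [hκi, hηi] with a h1 h2
    refine invariant_measure_unique (fun n => BatchQueue.numberAt mu Y T T n a 1)
      (fun n => isProbabilityMeasure_numberAt _ _ _ _) (fun n => n + 1) (fun n => ?_)
      (fun s t => ⟨t, s, by simp [add_comm]⟩) _ _ (fun m => ?_) (fun m => ?_)
    · simp only [BatchQueue.numberAt, BatchQueue.afterArrival]
      rw [bind_apply_singleton _ _ (measurableSet_singleton _)]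
      intro h0
      rcases mul_eq_zero.1 (ENNReal.tsum_eq_zero.1 h0 (n + 1)) with h | h
      · exact afterService_map_succ_ne_zero n _ h
      · exact afterService_self_ne_zero _ _ h
    · conv_lhs => rw [h1]
      exact bind_apply_singleton _ _ (measurableSet_singleton _)
    · conv_lhs => rw [h2]
      exact bind_apply_singleton _ _ (measurableSet_singleton _)
  have hs : P.map Prod.swap = Q.map Prod.swap := by
    rw [hPκ, hQη]
    exact Measure.compProd_congr heq
  have := congrArg (fun ν => ν.map Prod.swap) hs
  simpa [Measure.map_map measurable_swap measurable_swap] using this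

end Deterministic

/-! ### The decay rates of the stationary laws -/

section Roots

/-- The probability generating function of the batch size. -/
noncomputable def batchPgf (Y : Measure ℕ) (b : ℕ) (z : ℝ) : ℝ :=
  ∑ j ∈ Finset.range (b + 1), Y.real {j} * z ^ j

/-- The function `z ↦ (1 - batchPgf Y b z) / (1 - z)`, extended continuously to `z = 1`. -/
noncomputable def batchSlope (Y : Measure ℕ) (b : ℕ) (z : ℝ) : ℝ :=
  ∑ j ∈ Finset.range (b + 1), Y.real {j} * ∑ i ∈ Finset.range j, z ^ i

variable {Y : Measure ℕ} {b : ℕ}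

theorem ae_mem_range (hY : ∀ᵐ j ∂Y, 1 ≤ j ∧ j ≤ b) :
    ∀ᵐ j ∂Y, j ∈ (Finset.range (b + 1) : Set ℕ) :=
  hY.mono fun j hj => by simp; omega

theorem lintegral_batch (hY : ∀ᵐ j ∂Y, 1 ≤ j ∧ j ≤ b) (f : ℕ → ℝ≥0∞) :
    ∫⁻ j, f j ∂Y = ∑ j ∈ Finset.range (b + 1), f j * Y {j} := by
  rw [← Measure.restrict_eq_self_of_ae_mem (ae_mem_range hY), lintegral_finset]
  refine Finset.sum_congr rfl fun j hj => ?_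
  rw [Measure.restrict_apply (measurableSet_singleton j), Set.inter_eq_left.2 (by simpa using hj)]

theorem integral_batch [IsProbabilityMeasure Y] (hY : ∀ᵐ j ∂Y, 1 ≤ j ∧ j ≤ b) :
    ∫ j, (j : ℝ) ∂Y = ∑ j ∈ Finset.range (b + 1), Y.real {j} * j := by
  rw [integral_eq_lintegral_of_nonneg_ae (ae_of_all _ fun n => by positivity)
    Measurable.of_discrete.aestronglyMeasurable, lintegral_batch hY,
    ENNReal.toReal_sum fun j _ => ENNReal.mul_ne_top ENNReal.ofReal_ne_top (measure_ne_top _ _)]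
  refine Finset.sum_congr rfl fun j _ => ?_
  rw [ENNReal.toReal_mul, ENNReal.toReal_ofReal (by positivity), mul_comm, measureReal_def]

theorem lintegral_pow_batch [IsProbabilityMeasure Y] (hY : ∀ᵐ j ∂Y, 1 ≤ j ∧ j ≤ b) {z : ℝ} (hz : 0 ≤ z) :
    ∫⁻ j, ENNReal.ofReal z ^ j ∂Y = ENNReal.ofReal (batchPgf Y b z) := by
  rw [lintegral_batch hY, batchPgf, ENNReal.ofReal_sum_of_nonneg fun j _ => by positivity]
  refine Finset.sum_congr rfl fun j _ => ?_
  rw [ENNReal.ofReal_mul (by positivity), ENNReal.ofReal_pow hz, ofReal_measureReal, mul_comm]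

theorem sum_batch [IsProbabilityMeasure Y] (hY : ∀ᵐ j ∂Y, 1 ≤ j ∧ j ≤ b) :
    ∑ j ∈ Finset.range (b + 1), Y.real {j} = 1 := by
  have h := lintegral_pow_batch hY zero_le_one
  simp only [ENNReal.ofReal_one, one_pow, lintegral_one, measure_univ, batchPgf, mul_one] at h
  have := congrArg ENNReal.toReal h
  rw [ENNReal.toReal_ofReal (Finset.sum_nonneg fun j _ => by positivity)] at this
  simpa using this.symm

theorem one_sub_batchPgf [IsProbabilityMeasure Y] (hY : ∀ᵐ j ∂Y, 1 ≤ j ∧ j ≤ b) (z : ℝ) :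
    1 - batchPgf Y b z = (1 - z) * batchSlope Y b z := by
  have h : 1 - batchPgf Y b z = ∑ j ∈ Finset.range (b + 1), Y.real {j} - batchPgf Y b z := by
    rw [sum_batch hY]
  rw [h, batchPgf, batchSlope, ← Finset.sum_sub_distrib, Finset.mul_sum]
  refine Finset.sum_congr rfl fun j _ => ?_
  rw [mul_left_comm, mul_neg_geom_sum]
  ring

theorem batch_zero (hY : ∀ᵐ j ∂Y, 1 ≤ j ∧ j ≤ b) : Y.real {0} = 0 := by
  rw [measureReal_def, measure_mono_null (t := {j | ¬ (1 ≤ j ∧ j ≤ b)}) (by simp) hY,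
    ENNReal.toReal_zero]

theorem batchPgf_zero [IsProbabilityMeasure Y] (hY : ∀ᵐ j ∂Y, 1 ≤ j ∧ j ≤ b) : batchPgf Y b 0 = 0 := by
  rw [batchPgf, Finset.sum_range_succ']
  simp [batch_zero hY]

theorem batchPgf_nonneg {z : ℝ} (hz : 0 ≤ z) : 0 ≤ batchPgf Y b z :=
  Finset.sum_nonneg fun j _ => by positivity

theorem batchSlope_mono {z w : ℝ} (hz : 0 ≤ z) (hzw : z ≤ w) :
    batchSlope Y b z ≤ batchSlope Y b w := by
  unfold batchSlope
  gcongr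

theorem continuous_batchPgf : Continuous (batchPgf Y b) := by
  unfold batchPgf
  fun_prop

theorem continuous_batchSlope : Continuous (batchSlope Y b) := by
  unfold batchSlope
  fun_prop

theorem batchSlope_pos [IsProbabilityMeasure Y] (hY : ∀ᵐ j ∂Y, 1 ≤ j ∧ j ≤ b) {z : ℝ} (hz : 0 ≤ z) :
    0 < batchSlope Y b z := by
  have h1 : batchSlope Y b 0 = 1 := by
    have := one_sub_batchPgf hY 0
    rw [batchPgf_zero hY] at this
    linarith
  have := batchSlope_mono (Y := Y) (b := b) le_rfl hz
  linarith

theorem batchSlope_one [IsProbabilityMeasure Y] (hY : ∀ᵐ j ∂Y, 1 ≤ j ∧ j ≤ b) : batchSlope Y b 1 = ∫ j, (j : ℝ) ∂Y := by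
  rw [integral_batch hY]
  simp [batchSlope]

theorem batchPgf_lt_one [IsProbabilityMeasure Y] (hY : ∀ᵐ j ∂Y, 1 ≤ j ∧ j ≤ b) {z : ℝ} (hz : 0 ≤ z) (hz1 : z < 1) :
    batchPgf Y b z < 1 := by
  have := one_sub_batchPgf hY z
  have := mul_pos (sub_pos.2 hz1) (batchSlope_pos hY hz)
  linarith

/-- `(1 + x / k) ^ k` is nondecreasing in `k`. -/
theorem one_add_div_pow_le_succ {x : ℝ} (hx : 0 ≤ x) {k : ℕ} (hk : 1 ≤ k) :
    (1 + x / k) ^ k ≤ (1 + x / (k + 1 : ℕ)) ^ (k + 1) := by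
  have hk0 : (0 : ℝ) < k := by exact_mod_cast hk
  -- Bernoulli's inequality with the real exponent `(k + 1) / k`, to be raised to the power `k`.
  have h := one_add_mul_self_le_rpow_one_add (s := x / (k + 1 : ℕ)) (p := ((k + 1 : ℕ) : ℝ) / k)
    (by have : 0 ≤ x / (k + 1 : ℕ) := by positivity
        linarith) (by rw [le_div_iff₀ hk0]; push_cast; linarith)
  have h2 : ((k + 1 : ℕ) : ℝ) / k * (x / (k + 1 : ℕ)) = x / k := by
    field_simp
  rw [h2] at h
  calc (1 + x / k) ^ k ≤ ((1 + x / (k + 1 : ℕ)) ^ (((k + 1 : ℕ) : ℝ) / k)) ^ k := by gcongr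
    _ = _ := by
      rw [← Real.rpow_mul_natCast (by positivity), div_mul_cancel₀ _ hk0.ne', Real.rpow_natCast]

/-- `z` is the decay rate for inter-arrival times with `k` phases. -/
def IsErlangRoot (lam mu : ℝ) (Y : Measure ℕ) (b k : ℕ) (z : ℝ) : Prop :=
  0 < z ∧ z < 1 ∧ z * (1 + mu * (1 - batchPgf Y b z) / lam / k) ^ k = 1

variable {lam mu : ℝ}

/-- Dividing by `1 - z` removes the trivial root `1` and leaves `z * batchSlope Y b z = lam / mu`.
The left side runs from `0` to `E Y`, which exceeds `lam / mu` by stability. -/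
theorem exists_isErlangRoot_one [IsProbabilityMeasure Y] (hlam : 0 < lam) (hmu : 0 < mu)
    (hY : ∀ᵐ j ∂Y, 1 ≤ j ∧ j ≤ b) (hstable : lam < mu * ∫ j, (j : ℝ) ∂Y) :
    ∃ z, IsErlangRoot lam mu Y b 1 z := by
  have hc : ContinuousOn (fun z => z * batchSlope Y b z) (Set.Icc 0 1) :=
    (continuous_id.mul continuous_batchSlope).continuousOn
  have hmem : lam / mu ∈ Set.Ioo (0 * batchSlope Y b 0) (1 * batchSlope Y b 1) := by
    rw [zero_mul, one_mul, batchSlope_one hY]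
    exact ⟨by positivity, by rwa [div_lt_iff₀' hmu]⟩
  obtain ⟨z, hz, hzeq⟩ := intermediate_value_Ioo zero_le_one hc hmem
  refine ⟨z, hz.1, hz.2, ?_⟩
  simp only at hzeq
  rw [one_sub_batchPgf hY, Nat.cast_one, div_one, pow_one]
  rw [eq_div_iff hmu.ne'] at hzeq
  field_simp
  linear_combination (1 - z) * hzeq

/-- At the old root the new function is at least `1`, and at `0` it vanishes; the intermediate value
theorem applies in between. -/
theorem IsErlangRoot.exists_succ [IsProbabilityMeasure Y] (hlam : 0 < lam) (hmu : 0 < mu)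
    (hY : ∀ᵐ j ∂Y, 1 ≤ j ∧ j ≤ b) {k : ℕ} (hk : 1 ≤ k) {z : ℝ} (h : IsErlangRoot lam mu Y b k z) :
    ∃ w, IsErlangRoot lam mu Y b (k + 1) w ∧ w ≤ z := by
  obtain ⟨h0, h1, heq⟩ := h
  have hg := batchPgf_lt_one hY h0.le h1
  have hx : 0 ≤ mu * (1 - batchPgf Y b z) / lam :=
    div_nonneg (mul_nonneg hmu.le (by linarith)) hlam.le
  have hge : 1 ≤ z * (1 + mu * (1 - batchPgf Y b z) / lam / (k + 1 : ℕ)) ^ (k + 1) := by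
    exact heq.symm.le.trans (mul_le_mul_of_nonneg_left (one_add_div_pow_le_succ hx hk) h0.le)
  have hc : ContinuousOn
      (fun z => z * (1 + mu * (1 - batchPgf Y b z) / lam / (k + 1 : ℕ)) ^ (k + 1))
      (Set.Icc 0 z) := by
    have := continuous_batchPgf (Y := Y) (b := b)
    fun_prop
  obtain ⟨w, hw, hweq⟩ := intermediate_value_Icc h0.le hc
    (show (1 : ℝ) ∈ Set.Icc _ _ from ⟨by simp, hge⟩)
  refine ⟨w, ⟨lt_of_le_of_ne hw.1 ?_, hw.2.trans_lt h1, hweq⟩, hw.2⟩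
  rintro rfl
  simp at hweq

/-- Roots are chosen recursively, each below the last, so monotonicity needs no uniqueness of roots.
-/
theorem exists_erlangRoots [IsProbabilityMeasure Y] (hlam : 0 < lam) (hmu : 0 < mu)
    (hY : ∀ᵐ j ∂Y, 1 ≤ j ∧ j ≤ b) (hstable : lam < mu * ∫ j, (j : ℝ) ∂Y) :
    ∃ s : ℕ → ℝ, (∀ k, IsErlangRoot lam mu Y b (k + 1) (s k)) ∧ Antitone s := by
  choose! f hf using fun (k : ℕ) (z : ℝ) (h : IsErlangRoot lam mu Y b (k + 1) z) =>
    h.exists_succ hlam hmu hY (Nat.le_add_left 1 k)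
  obtain ⟨z, hz⟩ := exists_isErlangRoot_one hlam hmu hY hstable
  let s : ℕ → ℝ := fun n => Nat.rec z f n
  have hs : ∀ k, IsErlangRoot lam mu Y b (k + 1) (s k) := by
    intro k
    induction k with
    | zero => exact hz
    | succ k ih => exact (hf k _ ih).1
  exact ⟨s, hs, antitone_nat_of_succ_le fun k => (hf k _ (hs k)).2⟩

/-- The decay rates decrease to the decay rate for deterministic inter-arrival times. -/
theorem exists_limit_erlangRoots (hlam : 0 < lam) {s : ℕ → ℝ}
    (hs : ∀ k, IsErlangRoot lam mu Y b (k + 1) (s k)) (hanti : Antitone s) :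
    ∃ z, 0 < z ∧ (∀ k, z ≤ s k) ∧ Tendsto s atTop (𝓝 z) ∧
      z = Real.exp (-(mu * (1 - batchPgf Y b z) * (1 / lam))) := by
  have hb : BddBelow (Set.range s) := ⟨0, by rintro _ ⟨k, rfl⟩; exact (hs k).1.le⟩
  have hlim := tendsto_atTop_ciInf hanti hb
  set z := ⨅ k, s k with hzdef
  have hθ : Tendsto (fun k => mu * (1 - batchPgf Y b (s k)) / lam) atTop
      (𝓝 (mu * (1 - batchPgf Y b z) / lam)) := by
    have hcont : Continuous fun z => mu * (1 - batchPgf Y b z) / lam := by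
      have := continuous_batchPgf (Y := Y) (b := b)
      fun_prop
    exact (hcont.tendsto z).comp hlim
  have hshift : Tendsto (fun k : ℕ => (1 + mu * (1 - batchPgf Y b (s (k - 1))) / lam / k) ^ k) atTop
      (𝓝 (Real.exp (mu * (1 - batchPgf Y b z) / lam))) := by
    refine Real.tendsto_one_add_pow_exp_of_tendsto ?_
    refine (hθ.comp (tendsto_sub_atTop_nat 1)).congr' ?_
    filter_upwards [eventually_ge_atTop 1] with k hk
    have : (k : ℝ) ≠ 0 := by positivity
    simp only [Function.comp_apply]
    field_simp
  have hone : Tendsto (fun k : ℕ => s k *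
      (1 + mu * (1 - batchPgf Y b (s k)) / lam / (k + 1 : ℕ)) ^ (k + 1)) atTop
      (𝓝 (z * Real.exp (mu * (1 - batchPgf Y b z) / lam))) := by
    have := hlim.mul (hshift.comp (tendsto_add_atTop_nat 1))
    simpa using this
  have heq : z * Real.exp (mu * (1 - batchPgf Y b z) / lam) = 1 := by
    refine tendsto_nhds_unique hone ?_
    simp_rw [fun k => (hs k).2.2]
    exact tendsto_const_nhds
  have hz : z = Real.exp (-(mu * (1 - batchPgf Y b z) * (1 / lam))) := by
    rw [Real.exp_neg, eq_comm, inv_eq_iff_eq_inv, mul_one_div]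
    exact eq_inv_of_mul_eq_one_right heq
  exact ⟨z, hz ▸ Real.exp_pos _, fun k => ciInf_le hb k, hlim, hz⟩

/-! ### Monotonicity of the performance measures in the decay rate -/

/-- The mean number of customers when the decay rate is `z`. -/
noncomputable def meanOf (lam mu : ℝ) (Y : Measure ℕ) (b : ℕ) (z : ℝ) : ℝ :=
  lam / (mu * (1 - batchPgf Y b z))

/-- The variance of the number of customers when the decay rate is `z`. -/
noncomputable def varOf (lam mu : ℝ) (Y : Measure ℕ) (b : ℕ) (z : ℝ) : ℝ :=
  meanOf lam mu Y b z * (1 + z) / (1 - z) - meanOf lam mu Y b z ^ 2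

theorem batchPgf_mono {z w : ℝ} (hz : 0 ≤ z) (hzw : z ≤ w) : batchPgf Y b z ≤ batchPgf Y b w := by
  unfold batchPgf
  gcongr

theorem meanOf_pos [IsProbabilityMeasure Y] (hlam : 0 < lam) (hmu : 0 < mu) (hY : ∀ᵐ j ∂Y, 1 ≤ j ∧ j ≤ b) {z : ℝ}
    (hz : 0 ≤ z) (hz1 : z < 1) : 0 < meanOf lam mu Y b z :=
  div_pos hlam (mul_pos hmu (sub_pos.2 (batchPgf_lt_one hY hz hz1)))

theorem meanOf_mono [IsProbabilityMeasure Y] (hlam : 0 < lam) (hmu : 0 < mu) (hY : ∀ᵐ j ∂Y, 1 ≤ j ∧ j ≤ b) {z w : ℝ}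
    (hz : 0 ≤ z) (hzw : z ≤ w) (hw1 : w < 1) : meanOf lam mu Y b z ≤ meanOf lam mu Y b w := by
  have := sub_pos.2 (batchPgf_lt_one hY (hz.trans hzw) hw1)
  have := batchPgf_mono (Y := Y) (b := b) hz hzw
  unfold meanOf
  gcongr

/-- The product equals `lam / (mu * batchSlope Y b x)`, and the slope is a polynomial with
nonnegative coefficients. -/
theorem meanOf_mul_antitone [IsProbabilityMeasure Y] (hlam : 0 < lam) (hmu : 0 < mu) (hY : ∀ᵐ j ∂Y, 1 ≤ j ∧ j ≤ b)
    {z w : ℝ} (hz : 0 ≤ z) (hzw : z ≤ w) (hw1 : w < 1) :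
    meanOf lam mu Y b w * (1 - w) ≤ meanOf lam mu Y b z * (1 - z) := by
  have hval : ∀ x, x < 1 → meanOf lam mu Y b x * (1 - x) = lam / (mu * batchSlope Y b x) := by
    intro x hx
    have : 1 - x ≠ 0 := by linarith
    rw [meanOf, one_sub_batchPgf hY]
    by_cases h : batchSlope Y b x = 0
    · simp [h]
    · field_simp
  rw [hval _ hw1, hval _ (hzw.trans_lt hw1)]
  have := batchSlope_pos hY hz
  have := batchSlope_mono (Y := Y) (b := b) hz hzw
  gcongr

/-- In the notation of the proof the variances are `R * (2 * A - 1) - R ^ 2` and `r * (2 * B - 1) -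
r ^ 2`. Their difference is `(R - r) * (A + B - R - r) + R * (A - B) + (r * (A - B) - (R - r))`,
with all three terms nonnegative. The hypothesis `hz2` says that the first tail term is at most `1`;
it yields `r ≤ B` and `R ≤ A`. -/
theorem varOf_mono [IsProbabilityMeasure Y] (hlam : 0 < lam) (hmu : 0 < mu) (hY : ∀ᵐ j ∂Y, 1 ≤ j ∧ j ≤ b) {z w : ℝ}
    (hz : 0 ≤ z) (hzw : z ≤ w) (hw1 : w < 1) (hz2 : meanOf lam mu Y b z * (1 - z) ≤ 1) :
    varOf lam mu Y b z ≤ varOf lam mu Y b w := by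
  have hz1 := hzw.trans_lt hw1
  have hr := meanOf_pos hlam hmu hY hz hz1
  have hrR := meanOf_mono hlam hmu hY hz hzw hw1
  have hA := meanOf_mul_antitone hlam hmu hY hz hzw hw1
  unfold varOf
  set r := meanOf lam mu Y b z
  set R := meanOf lam mu Y b w
  set A := 1 / (1 - w) with hAdef
  set B := 1 / (1 - z) with hBdef
  have hw' : 0 < 1 - w := by linarith
  have hz' : 0 < 1 - z := by linarith
  have hB1 : 1 ≤ B := by rw [hBdef, le_div_iff₀ hz']; linarith
  have hAB : B ≤ A := one_div_le_one_div_of_le hw' (by linarith)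
  have hrB : r ≤ B := by rwa [hBdef, le_div_iff₀ hz']
  have hRA : R ≤ A := by rw [hAdef, le_div_iff₀ hw']; linarith
  have hRB : R * B ≤ r * A := by
    rw [hAdef, hBdef, mul_one_div, mul_one_div, div_le_div_iff₀ hz' hw']
    exact hA
  have e1 : R * (1 + w) / (1 - w) = R * (2 * A - 1) := by
    rw [hAdef]; field_simp; ring
  have e2 : r * (1 + z) / (1 - z) = r * (2 * B - 1) := by
    rw [hBdef]; field_simp; ring
  rw [e1, e2]
  have k1 : (R - r) ≤ r * (A - B) := by
    have : (R - r) * 1 ≤ (R - r) * B := mul_le_mul_of_nonneg_left hB1 (by linarith)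
    nlinarith
  have k2 : 0 ≤ (R - r) * (A + B - R - r) := mul_nonneg (by linarith) (by linarith)
  have k3 : 0 ≤ R * (A - B) := mul_nonneg (by linarith) (by linarith)
  nlinarith

end Roots

/-! ### Stationary laws for a given decay rate -/

section Laws

variable {lam mu : ℝ} {Y : Measure ℕ} {b : ℕ}

/-- Exponential tilting turns the gamma density of rate `r` into a multiple of the one of rate `r +
γ`. -/
theorem lintegral_exp_gammaMeasure {a r γ : ℝ} (ha : 0 < a) (hr : 0 < r) (hγ : 0 ≤ γ) :
    ∫⁻ x, ENNReal.ofReal (Real.exp (-(γ * x))) ∂(gammaMeasure a r) =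
      ENNReal.ofReal ((r / (r + γ)) ^ a) := by
  have hpdf : Measurable (gammaPDF a r) := (measurable_gammaPDFReal a r).ennreal_ofReal
  rw [gammaMeasure, lintegral_withDensity_eq_lintegral_mul _ hpdf (by fun_prop)]
  have h : ∀ x, (gammaPDF a r * fun x => ENNReal.ofReal (Real.exp (-(γ * x)))) x =
      ENNReal.ofReal ((r / (r + γ)) ^ a) * gammaPDF a (r + γ) x := by
    intro x
    rw [Pi.mul_apply, gammaPDF, gammaPDF,
      ← ENNReal.ofReal_mul (gammaPDFReal_nonneg ha hr x), ← ENNReal.ofReal_mul (by positivity)]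
    congr 1
    unfold gammaPDFReal
    split_ifs with hx
    · have hra : (r + γ) ^ a ≠ 0 := (Real.rpow_pos_of_pos (by positivity) a).ne'
      have hexp : Real.exp (-((r + γ) * x)) = Real.exp (-(r * x)) * Real.exp (-(γ * x)) := by
        rw [← Real.exp_add]; congr 1; ring
      rw [Real.div_rpow hr.le (by positivity), hexp]
      field_simp
    · simp
  simp_rw [h]
  have hpdf' : Measurable (gammaPDF a (r + γ)) := (measurable_gammaPDFReal a (r + γ)).ennreal_ofReal
  rw [lintegral_const_mul _ hpdf', lintegral_gammaPDF_eq_one ha (by positivity), mul_one]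

theorem ae_nonneg_gammaMeasure (a r : ℝ) : ∀ᵐ x ∂(gammaMeasure a r), 0 ≤ x := by
  have : {x : ℝ | ¬ 0 ≤ x} = Set.Iio 0 := by ext; simp
  rw [ae_iff, this, gammaMeasure, withDensity_apply _ measurableSet_Iio,
    lintegral_gammaPDF_of_nonpos le_rfl]

theorem lintegral_exp_uniformAge {T γ : ℝ} (hT : 0 < T) (hγ : 0 < γ) :
    ∫⁻ a, ENNReal.ofReal (Real.exp (-(γ * a))) ∂(uniformAge T) =
      ENNReal.ofReal ((1 - Real.exp (-(γ * T))) / (γ * T)) := by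
  rw [uniformAge, lintegral_smul_measure, Measure.restrict_congr_set Ico_ae_eq_Ioc,
    ← ofReal_integral_eq_lintegral_ofReal
      ((by fun_prop : Continuous fun a => Real.exp (-(γ * a))).integrableOn_Ioc)
      (ae_of_all _ fun t => (Real.exp_pos _).le),
    ← intervalIntegral.integral_of_le hT.le, smul_eq_mul, ← ENNReal.ofReal_mul (by positivity)]
  congr 1
  have hder : ∀ x ∈ Set.uIcc 0 T,
      HasDerivAt (fun a => -(Real.exp (-(γ * a)) / γ)) (Real.exp (-(γ * x))) x := by
    intro x _
    have h1 : HasDerivAt (fun a => -(γ * a)) (-γ) x := by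
      simpa [neg_mul] using (hasDerivAt_id x).const_mul (-γ)
    have := (h1.exp.div_const γ).neg
    rwa [mul_neg, neg_div, neg_neg, mul_div_assoc, div_self hγ.ne', mul_one] at this
  rw [intervalIntegral.integral_eq_sub_of_hasDerivAt hder
    ((by fun_prop : Continuous fun a => Real.exp (-(γ * a))).intervalIntegrable _ _)]
  simp only [mul_zero, neg_zero, Real.exp_zero]
  field_simp
  ring

theorem IsErlangRoot.exists_laws [IsProbabilityMeasure Y] (hlam : 0 < lam) (hmu : 0 < mu)
    (hY : ∀ᵐ j ∂Y, 1 ≤ j ∧ j ≤ b) {k : ℕ} (hk : 1 ≤ k) {s : ℝ}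
    (h : IsErlangRoot lam mu Y b k s) :
    (∃ P, IsErlangStationary lam mu Y k P ∧
      IsGeomTail (ENNReal.ofReal s) (ENNReal.ofReal (meanOf lam mu Y b s * (1 - s)))
        (numberLaw P)) ∧
    ∃ α, IsArrivalStationary mu Y (gammaMeasure k (k * lam)) α ∧
      meanSojourn mu Y α = ENNReal.ofReal (1 / (mu * (1 - batchPgf Y b s))) := by
  obtain ⟨h0, h1, heq⟩ := h
  have hk0 : (0 : ℝ) < k := by exact_mod_cast hk
  obtain ⟨α, hα⟩ := exists_isGeomTail_self h0 h1
  have hg := lintegral_pow_batch hY h0.le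
  have hg0 : 0 ≤ batchPgf Y b s := batchPgf_nonneg h0.le
  have hg1 := batchPgf_lt_one hY h0.le h1
  have hγ : 0 < mu * (1 - batchPgf Y b s) := mul_pos hmu (by linarith)
  rw [meanOf]
  set γ := mu * (1 - batchPgf Y b s) with hγdef
  have hx0 : 0 < k * lam / (k * lam + γ) := by positivity
  -- The base is the Laplace transform of a single phase at `γ`; the root equation says that its
  -- `k`-th power is `s`.
  have hxk : (k * lam / (k * lam + γ)) ^ k = s := by
    have h2 : k * lam / (k * lam + γ) = (1 + γ / lam / k)⁻¹ := by
      field_simp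
    rw [h2, inv_pow]
    exact (eq_inv_of_mul_eq_one_left heq).symm
  refine ⟨?_, α, ?_, meanSojourn_of_isGeomTail hα hg0 hg1 hg hmu⟩
  · obtain ⟨P, hP, hPn⟩ := exists_isErlangStationary hlam hmu hk hx0 hα hg0 hg1.le hg
      (by rw [← hγdef]; field_simp) hxk
    refine ⟨P, hP, ?_⟩
    convert hPn using 2
    -- With `x` the transform of one phase, `x / (1 - x) = k * lam / γ`, so the phase average of `x
    -- ^ (i + 1)` is `lam * (1 - s) / γ`.
    have hsum := mul_neg_geom_sum (k * lam / (k * lam + γ)) k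
    rw [hxk] at hsum
    simp_rw [pow_succ, ← Finset.sum_mul]
    rw [← hsum]
    field_simp
    ring
  · have := isProbabilityMeasure_gammaMeasure hk0 (mul_pos hk0 hlam)
    refine isArrivalStationary_of_isGeomTail hα hg0 hg hmu (ae_nonneg_gammaMeasure _ _) ?_
    rw [← hγdef, lintegral_exp_gammaMeasure hk0 (by positivity) hγ.le, Real.rpow_natCast, hxk]

theorem exists_deterministic_laws [IsProbabilityMeasure Y] (hlam : 0 < lam) (hmu : 0 < mu)
    (hY : ∀ᵐ j ∂Y, 1 ≤ j ∧ j ≤ b) {s : ℝ} (h0 : 0 < s) (h1 : s < 1)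
    (heq : s = Real.exp (-(mu * (1 - batchPgf Y b s) * (1 / lam)))) :
    (∃ P, IsDeterministicStationary mu Y (1 / lam) P ∧
      IsGeomTail (ENNReal.ofReal s) (ENNReal.ofReal (meanOf lam mu Y b s * (1 - s)))
        (numberLaw P)) ∧
    ∃ α, IsArrivalStationary mu Y (Measure.dirac (1 / lam)) α ∧
      meanSojourn mu Y α = ENNReal.ofReal (1 / (mu * (1 - batchPgf Y b s))) := by
  obtain ⟨α, hα⟩ := exists_isGeomTail_self h0 h1
  have hg := lintegral_pow_batch hY h0.le
  have hg0 : 0 ≤ batchPgf Y b s := batchPgf_nonneg h0.le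
  have hg1 := batchPgf_lt_one hY h0.le h1
  have hγ : 0 < mu * (1 - batchPgf Y b s) := mul_pos hmu (by linarith)
  have hT : 0 < 1 / lam := by positivity
  refine ⟨?_, α, ?_, meanSojourn_of_isGeomTail hα hg0 hg1 hg hmu⟩
  · obtain ⟨P, hP, hPn⟩ := exists_isDeterministicStationary hg0 hg hmu hT (by rw [← heq]) hα
    refine ⟨P, hP, ?_⟩
    convert hPn using 1
    rw [lintegral_exp_uniformAge hT hγ, ← heq, meanOf]
    congr 1
    field_simp
  · refine isArrivalStationary_of_isGeomTail hα hg0 hg hmu ?_ ?_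
    · rw [ae_dirac_iff measurableSet_Ici]
      exact hT.le
    · rw [lintegral_dirac' _ (by fun_prop), ← heq]

end Laws

theorem stochLE_of_isGeomTail {z w q r : ℝ≥0∞} {p p' : Measure ℕ} (h : IsGeomTail z q p)
    (h' : IsGeomTail w r p') (hzw : z ≤ w) (hqr : q ≤ r) : StochLE p p' := by
  intro M
  have := h.1
  have := h'.1
  cases M with
  | zero => simp
  | succ M =>
    rw [h.2, h'.2]
    gcongr

end BatchQueue

/-! ### The main theorem -/

open BatchQueue

theorem mainTheorem7 (lam mu : ℝ) (hlam : 0 < lam) (hmu : 0 < mu)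
    (b : ℕ) (Y : Measure ℕ) [IsProbabilityMeasure Y]
    (hY : ∀ᵐ j ∂Y, 1 ≤ j ∧ j ≤ b)
    (hstable : lam < mu * ∫ j, (j : ℝ) ∂Y) :
    -- the stationary laws exist and are unique
    (∀ k : ℕ, 1 ≤ k → ∃! P, BatchQueue.IsErlangStationary lam mu Y k P) ∧
    (∀ k : ℕ, 1 ≤ k → ∃! α, BatchQueue.IsArrivalStationary mu Y (gammaMeasure k (k * lam)) α) ∧
    (∃! P, BatchQueue.IsDeterministicStationary mu Y (1 / lam) P) ∧
    (∃! α, BatchQueue.IsArrivalStationary mu Y (Measure.dirac (1 / lam)) α) ∧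
    ∀ (P : ∀ k : ℕ, Measure (ℕ × Fin k)) (α : ℕ → Measure ℕ)
      (PD : Measure (ℕ × ℝ)) (αD : Measure ℕ),
      (∀ k : ℕ, 1 ≤ k → BatchQueue.IsErlangStationary lam mu Y k (P k)) →
      (∀ k : ℕ, 1 ≤ k →
        BatchQueue.IsArrivalStationary mu Y (gammaMeasure k (k * lam)) (α k)) →
      BatchQueue.IsDeterministicStationary mu Y (1 / lam) PD →
      BatchQueue.IsArrivalStationary mu Y (Measure.dirac (1 / lam)) αD →
      -- stochastic order when all batches have size one
      (Y {1} = 1 → ∀ k : ℕ, 1 ≤ k →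
        BatchQueue.StochLE (BatchQueue.numberLaw PD) (BatchQueue.numberLaw (P (k + 1))) ∧
        BatchQueue.StochLE (BatchQueue.numberLaw (P (k + 1))) (BatchQueue.numberLaw (P k))) ∧
      -- the means, variances and expected sojourn times are finite
      (∀ k : ℕ, 1 ≤ k → MemLp (fun n : ℕ => (n : ℝ)) 2 (BatchQueue.numberLaw (P k))) ∧
      MemLp (fun n : ℕ => (n : ℝ)) 2 (BatchQueue.numberLaw PD) ∧
      (∀ k : ℕ, 1 ≤ k → BatchQueue.meanSojourn mu Y (α k) ≠ ∞) ∧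
      BatchQueue.meanSojourn mu Y αD ≠ ∞ ∧
      -- the mean number of customers decreases to its value for deterministic arrivals
      (∀ k : ℕ, 1 ≤ k →
        BatchQueue.meanNumber (BatchQueue.numberLaw (P (k + 1))) ≤
          BatchQueue.meanNumber (BatchQueue.numberLaw (P k))) ∧
      Tendsto (fun k => BatchQueue.meanNumber (BatchQueue.numberLaw (P k))) atTop
        (𝓝 (BatchQueue.meanNumber (BatchQueue.numberLaw PD))) ∧
      -- so does the expected sojourn time
      (∀ k : ℕ, 1 ≤ k →
        BatchQueue.meanSojourn mu Y (α (k + 1)) ≤ BatchQueue.meanSojourn mu Y (α k)) ∧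
      Tendsto (fun k => BatchQueue.meanSojourn mu Y (α k)) atTop
        (𝓝 (BatchQueue.meanSojourn mu Y αD)) ∧
      -- so does the variance of the number of customers
      (∀ k : ℕ, 1 ≤ k →
        BatchQueue.varNumber (BatchQueue.numberLaw (P (k + 1))) ≤
          BatchQueue.varNumber (BatchQueue.numberLaw (P k))) ∧
      Tendsto (fun k => BatchQueue.varNumber (BatchQueue.numberLaw (P k))) atTop
        (𝓝 (BatchQueue.varNumber (BatchQueue.numberLaw PD))) := by
  obtain ⟨s, hs, hanti⟩ := exists_erlangRoots hlam hmu hY hstable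
  obtain ⟨z, hz0, hzs, hlim, hzeq⟩ := exists_limit_erlangRoots hlam hs hanti
  have hz1 : z < 1 := (hzs 0).trans_lt (hs 0).2.1
  -- The sequence starts at `0`, so `s (k - 1)` is the root for `k` phases.
  have hroot : ∀ k : ℕ, 1 ≤ k → IsErlangRoot lam mu Y b k (s (k - 1)) := by
    intro k hk
    have := hs (k - 1)
    rwa [Nat.sub_add_cancel hk] at this
  have hlaws := fun (k : ℕ) (hk : 1 ≤ k) => (hroot k hk).exists_laws hlam hmu hY hk
  obtain ⟨⟨PD₀, hPD₀, hPDt⟩, αD₀, hαD₀, hWD⟩ := exists_deterministic_laws hlam hmu hY hz0 hz1 hzeq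
  have hT : 0 < 1 / lam := by positivity
  have hgamma : ∀ k : ℕ, 1 ≤ k → IsProbabilityMeasure (gammaMeasure k (k * lam)) := by
    intro k hk
    have hk0 : (0 : ℝ) < k := by exact_mod_cast hk
    exact isProbabilityMeasure_gammaMeasure hk0 (mul_pos hk0 hlam)
  refine ⟨fun k hk => ?_, fun k hk => ?_, ?_, ?_, ?_⟩
  · obtain ⟨⟨P, hP, _⟩, _⟩ := hlaws k hk
    exact ⟨P, hP, fun Q hQ => isErlangStationary_unique hlam hmu hQ hP⟩
  · obtain ⟨_, α, hα, _⟩ := hlaws k hk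
    have := hgamma k hk
    exact ⟨α, hα, fun β hβ => isArrivalStationary_unique hβ hα⟩
  · exact ⟨PD₀, hPD₀, fun Q hQ => isDeterministicStationary_unique hT hQ hPD₀⟩
  · exact ⟨αD₀, hαD₀, fun β hβ => isArrivalStationary_unique hβ hαD₀⟩
  intro P α PD αD hP hα hPD hαD
  obtain rfl := isDeterministicStationary_unique hT hPD hPD₀
  obtain rfl := isArrivalStationary_unique hαD hαD₀
  have htail : ∀ k : ℕ, 1 ≤ k → IsGeomTail (ENNReal.ofReal (s (k - 1)))
      (ENNReal.ofReal (meanOf lam mu Y b (s (k - 1)) * (1 - s (k - 1)))) (numberLaw (P k)) := by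
    intro k hk
    obtain ⟨⟨Q, hQ, ht⟩, _⟩ := hlaws k hk
    rwa [isErlangStationary_unique hlam hmu (hP k hk) hQ]
  have hW : ∀ k : ℕ, 1 ≤ k → meanSojourn mu Y (α k) =
      ENNReal.ofReal (1 / (mu * (1 - batchPgf Y b (s (k - 1))))) := by
    intro k hk
    obtain ⟨_, β, hβ, ht⟩ := hlaws k hk
    have := hgamma k hk
    rwa [isArrivalStationary_unique (hα k hk) hβ]
  have hq : ∀ x, 0 < x → x < 1 → 0 ≤ meanOf lam mu Y b x * (1 - x) := fun x hx0 hx1 =>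
    mul_nonneg (meanOf_pos hlam hmu hY hx0.le hx1).le (by linarith)
  have hs0 : ∀ k, 0 < s k := fun k => (hs k).1
  have hs1 : ∀ k, s k < 1 := fun k => (hs k).2.1
  have hmean : ∀ {p x}, 0 < x → x < 1 → IsGeomTail (ENNReal.ofReal x)
      (ENNReal.ofReal (meanOf lam mu Y b x * (1 - x))) p → meanNumber p = meanOf lam mu Y b x := by
    intro p x hx0 hx1 h
    rw [h.meanNumber_eq hx0 hx1 (hq x hx0 hx1), mul_div_assoc, div_self (by linarith), mul_one]
  have hvar : ∀ {p x}, 0 < x → x < 1 → IsGeomTail (ENNReal.ofReal x)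
      (ENNReal.ofReal (meanOf lam mu Y b x * (1 - x))) p → varNumber p = varOf lam mu Y b x := by
    intro p x hx0 hx1 h
    have : 1 - x ≠ 0 := by linarith
    rw [h.varNumber_eq hx0 hx1 (hq x hx0 hx1), varOf]
    field_simp
  -- The left side is the stationary probability that the system is not empty.
  have hle1 : ∀ k, meanOf lam mu Y b (s k) * (1 - s k) ≤ 1 := by
    intro k
    have h := htail (k + 1) (Nat.le_add_left 1 k)
    have := h.1
    have h2 := h.2 0
    rw [pow_zero, mul_one] at h2
    have h3 : numberLaw (P (k + 1)) (Set.Ici (0 + 1)) ≤ 1 := prob_le_one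
    rw [h2, ENNReal.ofReal_le_one] at h3
    simpa using h3
  have hstep : ∀ k : ℕ, 1 ≤ k → s (k + 1 - 1) ≤ s (k - 1) := fun k _ => hanti (by omega)
  have hgz := batchPgf_lt_one hY hz0.le hz1
  have hlim' : Tendsto (fun k : ℕ => s (k - 1)) atTop (𝓝 z) :=
    hlim.comp (tendsto_sub_atTop_nat 1)
  have hcg : ContinuousAt (batchPgf Y b) z := continuous_batchPgf.continuousAt
  have hne : mu * (1 - batchPgf Y b z) ≠ 0 := (mul_pos hmu (by linarith)).ne'
  have hcm : ContinuousAt (meanOf lam mu Y b) z :=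
    continuousAt_const.div (continuousAt_const.mul (continuousAt_const.sub hcg)) hne
  have hcv : ContinuousAt (varOf lam mu Y b) z :=
    ((hcm.mul (continuousAt_const.add continuousAt_id)).div
      (continuousAt_const.sub continuousAt_id) (sub_pos.2 hz1).ne').sub (hcm.pow 2)
  have hcw : ContinuousAt (fun x => ENNReal.ofReal (1 / (mu * (1 - batchPgf Y b x)))) z :=
    ENNReal.continuous_ofReal.continuousAt.comp
      (continuousAt_const.div (continuousAt_const.mul (continuousAt_const.sub hcg)) hne)
  refine ⟨fun hY1 k hk => ?_, fun k hk => (htail k hk).memLp (hs0 _) (hs1 _) (hq _ (hs0 _) (hs1 _)),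
    hPDt.memLp hz0 hz1 (hq _ hz0 hz1), fun k hk => ?_, ?_, fun k hk => ?_, ?_, fun k hk => ?_, ?_,
    fun k hk => ?_, ?_⟩
  -- For unit batches the generating function is the identity, so all the laws share their first
  -- tail term and are ordered by the ratio alone.
  · have hconst : ∀ x, 0 ≤ x → x < 1 → meanOf lam mu Y b x * (1 - x) = lam / mu := by
      intro x hx hx1
      have hpg : batchPgf Y b x = x := by
        have hae : ∀ᵐ j ∂Y, j = 1 := by
          rw [ae_iff]
          exact (prob_compl_eq_zero_iff (measurableSet_singleton 1)).2 hY1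
        have h := lintegral_pow_batch hY hx
        rw [lintegral_congr_ae (g := fun _ => ENNReal.ofReal x)
          (hae.mono fun j hj => by rw [hj, pow_one])] at h
        simp only [lintegral_const, measure_univ, mul_one] at h
        exact ((ENNReal.ofReal_eq_ofReal_iff hx (batchPgf_nonneg hx)).1 h).symm
      have : 1 - x ≠ 0 := by linarith
      rw [meanOf, hpg]
      field_simp
    have h1 := htail k hk
    have h2 := htail (k + 1) (by omega)
    rw [hconst _ (hs0 _).le (hs1 _)] at h1 h2
    have h3 := hPDt
    rw [hconst _ hz0.le hz1] at h3
    exact ⟨stochLE_of_isGeomTail h3 h2 (ENNReal.ofReal_le_ofReal (hzs _)) le_rfl,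
      stochLE_of_isGeomTail h2 h1 (ENNReal.ofReal_le_ofReal (hstep k hk)) le_rfl⟩
  · rw [hW k hk]; exact ENNReal.ofReal_ne_top
  · rw [hWD]; exact ENNReal.ofReal_ne_top
  · rw [hmean (hs0 _) (hs1 _) (htail k hk), hmean (hs0 _) (hs1 _) (htail (k + 1) (by omega))]
    exact meanOf_mono hlam hmu hY (hs0 _).le (hstep k hk) (hs1 _)
  · rw [hmean hz0 hz1 hPDt]
    refine (hcm.tendsto.comp hlim').congr' ?_
    filter_upwards [eventually_ge_atTop 1] with k hk
    exact (hmean (hs0 _) (hs1 _) (htail k hk)).symm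
  · rw [hW k hk, hW (k + 1) (by omega)]
    refine ENNReal.ofReal_le_ofReal (one_div_le_one_div_of_le
      (mul_pos hmu (sub_pos.2 (batchPgf_lt_one hY (hs0 _).le (hs1 _)))) ?_)
    have := batchPgf_mono (Y := Y) (b := b) (hs0 _).le (hstep k hk)
    gcongr
  · rw [hWD]
    refine (hcw.tendsto.comp hlim').congr' ?_
    filter_upwards [eventually_ge_atTop 1] with k hk
    exact (hW k hk).symm
  · rw [hvar (hs0 _) (hs1 _) (htail k hk), hvar (hs0 _) (hs1 _) (htail (k + 1) (by omega))]
    exact varOf_mono hlam hmu hY (hs0 _).le (hstep k hk) (hs1 _) (hle1 _)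
  · rw [hvar hz0 hz1 hPDt]
    refine (hcv.tendsto.comp hlim').congr' ?_
    filter_upwards [eventually_ge_atTop 1] with k hk
    exact (hvar (hs0 _) (hs1 _) (htail k hk)).symm
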